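/- **Setting.** All logarithms are natural, all systems are finite-dimensional, and $0\le \mathsf T\le \mathsf N$, $\mathsf F\ge 2$. A QPIR protocol with $\mathsf N$ servers and $\mathsf F$ files of size $\mathsf M$ consists of: a state $\rho_{\mathrm{prev}}$ on $\mathcal A_1'\otimes\cdots\otimes\mathcal A_{\mathsf N}'$ (each factor of dimension $\mathsf D'$) shared by the servers; a randomized user encoder, which maps the target index $K\in\{1,\dots,\mathsf F\}$ to queries $Q=(Q_1,\dots,Q_{\mathsf N})\in\mathcal Q_1\times\cdots\times\mathcal Q_{\mathsf N}$ (finite sets); for each server $s$, query $q_s$ and collection of files $m=(m_1,\dots,m_{\mathsf F})\in\{1,\dots,\mathsf M\}^{\mathsf F}$, a trace-preserving completely positive map $\Lambda_s=\Lambda_s(q_s,m)$ from $\mathcal A_s'$ to a $\mathsf D$-dimensional system $\mathcal A_s$; and, for each $(k,q)$, a decoding POVM on $\mathcal A=\mathcal A_1\otimes\cdots\otimes\mathcal A_{\mathsf N}$ with outcomes in $\{1,\dots,\mathsf M\}$. The files $M=(M_1,\dots,M_{\mathsf F})$ are independent and uniform, $K$ is uniform, and $M$ is independent of $(K,Q)$.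 Given $M=m$, $Q=q$, the state of $\mathcal A$ is $\rho(m,q)=(\Lambda_1\otimes\cdots\otimes\Lambda_{\mathsf N})(\rho_{\mathrm{prev}})$. Information quantities are those of the resulting classical-quantum states, with $H(\rho)=-\operatorname{Tr}\rho\log\rho$, $H(A|B)=H(AB)-H(B)$, $I(A;B)=H(A)-H(A|B)$ and $I(A;B|C)=H(A|C)-H(A|BC)$. Let $M_k^c$ be the collection of all files except $M_k$. For a permutation $\pi$ of $\{1,\dots,\mathsf N\}$ let $Q_{\pi,\mathsf T}=(Q_{\pi(1)},\dots,Q_{\pi(\mathsf T)})$ and $\mathcal A_{\pi,\mathsf T}=\mathcal A_{\pi(1)}\otimes\cdots\otimes\mathcal A_{\pi(\mathsf T)}$. The server secrecy and the user $\mathsf T$-secrecy are $$S_{\mathrm{serv}}=\max_{k,q:\ \Pr[Q=q,K=k]\neq 0} I(M_k^c;\mathcal A\,|\,Q=q,K=k),\qquad S_{\mathrm{user}}^{(\mathsf T)}=\max_{\pi} I(K;Q_{\pi,\mathsf T}).$$ Let $h_2(x)=-x\log x-(1-x)\log(1-x)$ for $0\le x\le 1$ and $h_2(x)=0$ for $x>1$;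 let $\eta_0(x)=-x\log x$ for $0\le x\le 1/e$ (with $\eta_0(0)=0$) and $\eta_0(x)=1/e$ for $x>1/e$. **Lemma 5.** Suppose that $S_{\mathrm{serv}}\le\beta$ and $S_{\mathrm{user}}^{(\mathsf T)}\le\gamma$. Then, for every permutation $\pi$ and every $k\in\{1,\dots,\mathsf F\}$, $$I(M_k;\mathcal A_{\pi,\mathsf T}\,|\,Q_{\pi,\mathsf T},K=k)\ \le\ \beta+10\sqrt{2\mathsf F\gamma}\,\log\mathsf M+\eta_0\!\left(2\sqrt{2\mathsf F\gamma}\right)+2h_2\!\left(2\sqrt{2\mathsf F\gamma}\right).$$ In particular, when $\gamma=0$, $I(M_k;\mathcal A_{\pi,\mathsf T}\,|\,Q_{\pi,\mathsf T},K=k)\le\beta$. -/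

import Mathlib

open scoped ComplexOrder

noncomputable section

namespace QPIR

/-! ### Entropies and partial traces (natural logarithm throughout) -/

/-- The von Neumann entropy `H(ρ) = -Tr ρ log ρ = -∑ λ log λ`, the sum over the eigenvalues of `ρ`
with multiplicity. It is only used for Hermitian matrices (the value `0` elsewhere is a default). -/
def vnEntropy {A : Type*} [Fintype A] [DecidableEq A] (ρ : Matrix A A ℂ) : ℝ := by
  classical
  exact if h : ρ.IsHermitian then ∑ i, Real.negMulLog (h.eigenvalues i) else 0

/-- `Tr_A ρ` for a matrix `ρ` on `A ⊗ B`. -/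
def traceFst {A B : Type*} [Fintype A] (ρ : Matrix (A × B) (A × B) ℂ) : Matrix B B ℂ :=
  fun b b' => ∑ a, ρ (a, b) (a, b')

/-- `Tr_B ρ` for a matrix `ρ` on `A ⊗ B`. -/
def traceSnd {A B : Type*} [Fintype B] (ρ : Matrix (A × B) (A × B) ℂ) : Matrix A A ℂ :=
  fun a a' => ∑ b, ρ (a, b) (a', b)

/-- `Tr_B ρ` for a matrix `ρ` on `A ⊗ B ⊗ C`. -/
def traceMid {A B C : Type*} [Fintype B] (ρ : Matrix (A × B × C) (A × B × C) ℂ) :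
    Matrix (A × C) (A × C) ℂ :=
  fun x x' => ∑ b, ρ (x.1, b, x.2) (x'.1, b, x'.2)

/-- `I(A;B) = H(A) - H(A|B)`, where `H(A|B) = H(AB) - H(B)`. -/
def mutualInfo {A B : Type*} [Fintype A] [DecidableEq A] [Fintype B] [DecidableEq B]
    (ρ : Matrix (A × B) (A × B) ℂ) : ℝ :=
  vnEntropy (traceSnd ρ) - (vnEntropy ρ - vnEntropy (traceFst ρ))

/-- `I(A;B|C) = H(A|C) - H(A|BC)`, where `H(A|C) = H(AC) - H(C)`
and `H(A|BC) = H(ABC) - H(BC)`. -/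
def condMutualInfo {A B C : Type*} [Fintype A] [DecidableEq A] [Fintype B] [DecidableEq B]
    [Fintype C] [DecidableEq C] (ρ : Matrix (A × B × C) (A × B × C) ℂ) : ℝ :=
  (vnEntropy (traceMid ρ) - vnEntropy (traceFst (traceFst ρ)))
    - (vnEntropy ρ - vnEntropy (traceFst ρ))

/-- The Shannon entropy of a distribution on a finite set. -/
def shannonEntropy {X : Type*} [Fintype X] (p : X → ℝ) : ℝ :=
  ∑ x, Real.negMulLog (p x)

/-- The classical mutual information `I(X;Y) = H(X) + H(Y) - H(XY)` of a joint distribution. -/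
def classicalMutualInfo {X Y : Type*} [Fintype X] [Fintype Y] (p : X × Y → ℝ) : ℝ :=
  shannonEntropy (fun x => ∑ y, p (x, y)) + shannonEntropy (fun y => ∑ x, p (x, y))
    - shannonEntropy p

/-- The binary entropy `h₂(x) = -x log x - (1-x) log (1-x)` on `[0,1]`, extended by `0`. -/
def h2 (x : ℝ) : ℝ :=
  if 0 ≤ x ∧ x ≤ 1 then Real.binEntropy x else 0

/-- `η₀(x) = -x log x` for `0 ≤ x ≤ 1/e` (so `η₀(0) = 0`), and `η₀(x) = 1/e` for `x > 1/e`. -/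
def eta0 (x : ℝ) : ℝ :=
  if (Real.exp 1)⁻¹ < x then (Real.exp 1)⁻¹ else Real.negMulLog x

/-! ### Quantum operations -/

/-- `κ ⊗ ι` on `ℂ^{d'} ⊗ ℂ^n`, where `ι` is the identity map of the second factor. -/
def ampliate {d' d : ℕ}
    (κ : Matrix (Fin d') (Fin d') ℂ →ₗ[ℂ] Matrix (Fin d) (Fin d) ℂ) (n : ℕ)
    (X : Matrix (Fin d' × Fin n) (Fin d' × Fin n) ℂ) :
    Matrix (Fin d × Fin n) (Fin d × Fin n) ℂ :=
  fun i j => κ (Matrix.of fun a b => X (a, i.2) (b, j.2)) i.1 j.1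

/-- Trace-preserving completely positive maps from a `d'`- to a `d`-dimensional system. -/
structure Channel (d' d : ℕ) where
  toMap : Matrix (Fin d') (Fin d') ℂ →ₗ[ℂ] Matrix (Fin d) (Fin d) ℂ
  tracePreserving : ∀ X, (toMap X).trace = X.trace
  completelyPositive : ∀ (n : ℕ) (X : Matrix (Fin d' × Fin n) (Fin d' × Fin n) ℂ),
    X.PosSemidef → (ampliate toMap n X).PosSemidef

/-- `(Λ_1 ⊗ ⋯ ⊗ Λ_N)(X)`, written by linearity in the matrix units
`E_{x'y'} = ⊗_s E_{x'_s y'_s}`. -/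
def tensorApply {N d' d : ℕ} (Λ : Fin N → Channel d' d)
    (X : Matrix (Fin N → Fin d') (Fin N → Fin d') ℂ) :
    Matrix (Fin N → Fin d) (Fin N → Fin d) ℂ :=
  fun x y => ∑ x', ∑ y', X x' y' *
    ∏ s, (Λ s).toMap (Matrix.single (x' s) (y' s) (1 : ℂ)) (x s) (y s)

/-- The reduced state on the systems `π(1), …, π(T)` of a state on `N` systems: the other systems
`π(T+1), …, π(N)` are traced out. -/
def reduce {N T d : ℕ} (hT : T ≤ N) (π : Equiv.Perm (Fin N))
    (X : Matrix (Fin N → Fin d) (Fin N → Fin d) ℂ) :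
    Matrix (Fin T → Fin d) (Fin T → Fin d) ℂ :=
  fun a a' => ∑ x, ∑ x',
    if (∀ j, x (π (Fin.castLE hT j)) = a j) ∧ (∀ j, x' (π (Fin.castLE hT j)) = a' j) ∧
        (∀ j : Fin N, T ≤ (j : ℕ) → x (π j) = x' (π j))
    then X x x' else 0

/-! ### Protocols -/

/-- A QPIR protocol with `N` servers, `F` files of size `M`, finite query sets `𝒬 s`, initial local
dimension `D'` and answer dimension `D`. -/
structure Protocol (N F M D' D : ℕ) (𝒬 : Fin N → Type*) [∀ s, Fintype (𝒬 s)] where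
  /-- the state shared by the servers -/
  sharedState : Matrix (Fin N → Fin D') (Fin N → Fin D') ℂ
  sharedState_posSemidef : sharedState.PosSemidef
  sharedState_trace : sharedState.trace = 1
  /-- the randomized user encoder: `encUser k q = Pr[Q = q | K = k]` -/
  encUser : Fin F → (∀ s, 𝒬 s) → ℝ
  encUser_nonneg : ∀ k q, 0 ≤ encUser k q
  encUser_sum : ∀ k, ∑ q, encUser k q = 1
  /-- the server encoders: server `s` chooses its operation from its query and the files -/
  encServ : ∀ s, 𝒬 s → (Fin F → Fin M) → Channel D' D
  /-- the decoder: a POVM for every target index and query -/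
  dec : Fin F → (∀ s, 𝒬 s) → Fin M → Matrix (Fin N → Fin D) (Fin N → Fin D) ℂ
  dec_posSemidef : ∀ k q w, (dec k q w).PosSemidef
  dec_sum : ∀ k q, ∑ w, dec k q w = 1

namespace Protocol

variable {N F M D' D : ℕ} {𝒬 : Fin N → Type*} [∀ s, Fintype (𝒬 s)] [∀ s, DecidableEq (𝒬 s)]

/-- The state `ρ(m,q)` of all answer systems. -/
def answerState (Ψ : Protocol N F M D' D 𝒬) (m : Fin F → Fin M) (q : ∀ s, 𝒬 s) :
    Matrix (Fin N → Fin D) (Fin N → Fin D) ℂ :=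
  tensorApply (fun s => Ψ.encServ s (q s) m) Ψ.sharedState

/-- The joint state of `(M_k^c, 𝒜)` given `Q = q` and `K = k`, where the files are uniform. -/
def serverState (Ψ : Protocol N F M D' D 𝒬) (k : Fin F) (q : ∀ s, 𝒬 s) :
    Matrix (({i : Fin F // i ≠ k} → Fin M) × (Fin N → Fin D))
      (({i : Fin F // i ≠ k} → Fin M) × (Fin N → Fin D)) ℂ :=
  fun x x' => if x.1 = x'.1 then
      ∑ m : Fin F → Fin M, if (∀ i : {i : Fin F // i ≠ k}, m i = x.1 i)
        then ((M : ℂ) ^ F)⁻¹ * Ψ.answerState m q x.2 x'.2 else 0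
    else 0

/-- The server secrecy: the maximum of `I(M_k^c; 𝒜 | Q = q, K = k)` over the pairs `(k, q)` of
positive probability. -/
def serverSecrecy (Ψ : Protocol N F M D' D 𝒬) : ℝ :=
  ⨆ x : {x : Fin F × (∀ s, 𝒬 s) // Ψ.encUser x.1 x.2 ≠ 0},
    mutualInfo (Ψ.serverState x.1.1 x.1.2)

/-- The queries `Q_{π,T} = (Q_{π(1)}, …, Q_{π(T)})` of the colluding servers. -/
def colludingQueries {T : ℕ} (hT : T ≤ N) (π : Equiv.Perm (Fin N)) (q : ∀ s, 𝒬 s) :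
    ∀ j : Fin T, 𝒬 (π (Fin.castLE hT j)) :=
  fun j => q (π (Fin.castLE hT j))

/-- The joint distribution of `(K, Q_{π,T})`, where `K` is uniform. -/
def jointIndexQuery (Ψ : Protocol N F M D' D 𝒬) {T : ℕ} (hT : T ≤ N) (π : Equiv.Perm (Fin N)) :
    Fin F × (∀ j : Fin T, 𝒬 (π (Fin.castLE hT j))) → ℝ :=
  fun x => ∑ q : (∀ s, 𝒬 s),
    if colludingQueries hT π q = x.2 then (F : ℝ)⁻¹ * Ψ.encUser x.1 q else 0

/-- The user `T`-secrecy: the maximum of `I(K; Q_{π,T})` over all permutations `π`. -/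
def userSecrecy (Ψ : Protocol N F M D' D 𝒬) {T : ℕ} (hT : T ≤ N) : ℝ :=
  ⨆ π : Equiv.Perm (Fin N), classicalMutualInfo (Ψ.jointIndexQuery hT π)

/-- The joint state of `(M_k, 𝒜_T, Q_T)` given `K = k`: the files are uniform and independent of
the queries, and the answers of all servers but `π(1), …, π(T)` are traced out. -/
def colludingState (Ψ : Protocol N F M D' D 𝒬) {T : ℕ} (hT : T ≤ N) (π : Equiv.Perm (Fin N))
    (k : Fin F) :
    Matrix (Fin M × (Fin T → Fin D) × (∀ j : Fin T, 𝒬 (π (Fin.castLE hT j))))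
      (Fin M × (Fin T → Fin D) × (∀ j : Fin T, 𝒬 (π (Fin.castLE hT j)))) ℂ :=
  fun x x' => if x.1 = x'.1 ∧ x.2.2 = x'.2.2 then
      ∑ m : Fin F → Fin M, ∑ q : (∀ s, 𝒬 s),
        if m k = x.1 ∧ colludingQueries hT π q = x.2.2
        then ((M : ℂ) ^ F)⁻¹ * (Ψ.encUser k q : ℂ) *
          reduce hT π (Ψ.answerState m q) x.2.1 x'.2.1 else 0
    else 0

/-- `I(M_k; 𝒜_T | Q_T, K = k)`. -/
def colludingInfo (Ψ : Protocol N F M D' D 𝒬) {T : ℕ} (hT : T ≤ N) (π : Equiv.Perm (Fin N))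
    (k : Fin F) : ℝ :=
  condMutualInfo (Ψ.colludingState hT π k)

end Protocol

end QPIR

end

/-! The colluding servers see only their own queries, so by no-signalling the joint state of `M_k`
and their answers depends on the colluding queries `c` alone and not on the target index. Let `f c`
be its mutual information. The quantity to bound is the average of `f` under the law `P_k` of the
colluding queries given target `k`.

Choose another target `i ≠ k`, which `F ≥ 2` permits. For target `i` the file `M_k` belongs to the
files that server secrecy protects. Discarding the remaining files and the answers of the other
servers cannot increase mutual information, so `f c ≤ β` whenever `P_i c > 0`. The average of `f`
under `P_i` is thus at most `β`. Since `0 ≤ f ≤ log M`, passing from `P_i` to `P_k` costs at most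
`‖P_k - P_i‖₁ log M`. User secrecy bounds this distance by `4 √(F γ)`: mutual information dominates
a squared Hellinger distance, and Cauchy–Schwarz turns that into an `ℓ¹` distance. The result is `β
+ 4 √(F γ) log M`, which is stronger than the stated bound, whose remaining terms are nonnegative.

The analytic core is monotonicity of relative entropy under partial trace. The relative entropy is a
limit of integrals over `t` of `Tr ρ (t R_ρ + L_σ)⁻¹ ρ`, and each integrand is a supremum over test
matrices `X`. A test matrix `X` for the reduced states lifts to `X ⊗ 1` with the same value, so the
supremum cannot grow under partial trace. The same comparison yields `f ≤ log M` and `0 ≤ f`. -/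

noncomputable section

namespace QPIR

open Matrix Kronecker Filter Topology

/-! ### Entropy computed in an arbitrary eigenbasis -/

section Diagonalization

variable {n m : Type*} [Fintype n] [DecidableEq n] [Fintype m] [DecidableEq m]

/-- `ρ = U diag(p) U†` with `U` unitary and `p` real. -/
def Diagonalizes (U : Matrix n n ℂ) (p : n → ℝ) (ρ : Matrix n n ℂ) : Prop :=
  Uᴴ * U = 1 ∧ ρ = U * diagonal (fun i => (p i : ℂ)) * Uᴴ

theorem exists_diagonalizes {ρ : Matrix n n ℂ} (h : ρ.IsHermitian) :
    ∃ U p, Diagonalizes U p ρ := by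
  refine ⟨h.eigenvectorUnitary, h.eigenvalues, ?_, ?_⟩
  · rw [← star_eq_conjTranspose]
    exact Unitary.coe_star_mul_self _
  · have := h.spectral_theorem
    rw [Unitary.conjStarAlgAut_apply] at this
    exact this

namespace Diagonalizes

variable {U : Matrix n n ℂ} {p : n → ℝ} {ρ : Matrix n n ℂ}
  {V : Matrix m m ℂ} {q : m → ℝ} {σ : Matrix m m ℂ}

theorem mul_conjTranspose (h : Diagonalizes U p ρ) : U * Uᴴ = 1 :=
  mul_eq_one_comm.mp h.1

theorem isHermitian (h : Diagonalizes U p ρ) : ρ.IsHermitian := by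
  rw [h.2, IsHermitian, conjTranspose_mul, conjTranspose_mul, diagonal_conjTranspose,
    conjTranspose_conjTranspose, ← Matrix.mul_assoc]
  congr 3
  ext i
  simp

theorem conj_eq_diagonal (h : Diagonalizes U p ρ) :
    Uᴴ * ρ * U = diagonal (fun i => (p i : ℂ)) := by
  rw [h.2, Matrix.mul_assoc, Matrix.mul_assoc, h.1, ← Matrix.mul_assoc, ← Matrix.mul_assoc, h.1]
  simp

theorem nonneg (h : Diagonalizes U p ρ) (hρ : ρ.PosSemidef) (i : n) : 0 ≤ p i := by
  have := (hρ.conjTranspose_mul_mul_same U).diag_nonneg (i := i)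
  rw [h.conj_eq_diagonal] at this
  simpa using this

/-- The characteristic polynomial determines the eigenvalues as a multiset, so any diagonalization
gives the same sum. -/
theorem vnEntropy_eq (h : Diagonalizes U p ρ) : vnEntropy ρ = ∑ i, Real.negMulLog (p i) := by
  have hchar : ρ.charpoly = (diagonal (fun i => (p i : ℂ))).charpoly := by
    rw [h.2, charpoly_mul_comm, ← Matrix.mul_assoc, h.1, Matrix.one_mul]
  have hroots := h.isHermitian.roots_charpoly_eq_eigenvalues
  have hdiag := Polynomial.roots_multiset_prod_X_sub_C
    (Finset.univ.val.map fun i => (p i : ℂ))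
  rw [Multiset.map_map] at hdiag
  rw [hchar, charpoly_diagonal] at hroots
  replace hroots := hdiag.symm.trans hroots
  have hmap := congrArg (Multiset.map fun z : ℂ => Real.negMulLog z.re) hroots
  rw [Multiset.map_map, Multiset.map_map] at hmap
  have hsum : ∑ i, Real.negMulLog (h.isHermitian.eigenvalues i) = ∑ i, Real.negMulLog (p i) :=
    congrArg Multiset.sum hmap.symm
  unfold vnEntropy
  rw [dif_pos h.isHermitian]
  convert hsum

theorem reindex (h : Diagonalizes U p ρ) (e : m ≃ n) :
    Diagonalizes (U.submatrix e e) (p ∘ e) (ρ.submatrix e e) := by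
  refine ⟨?_, ?_⟩
  · rw [conjTranspose_submatrix, submatrix_mul_equiv, h.1, submatrix_one_equiv]
  · have : diagonal (fun i => (((p ∘ e) i : ℝ) : ℂ))
        = (diagonal (fun i => (p i : ℂ))).submatrix e e := by
      rw [submatrix_diagonal_equiv]; rfl
    rw [this, conjTranspose_submatrix, submatrix_mul_equiv, submatrix_mul_equiv, ← h.2]

theorem kronecker (h : Diagonalizes U p ρ) (h' : Diagonalizes V q σ) :
    Diagonalizes (U ⊗ₖ V) (fun x => p x.1 * q x.2) (ρ ⊗ₖ σ) := by
  refine ⟨?_, ?_⟩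
  · rw [conjTranspose_kronecker, ← mul_kronecker_mul, h.1, h'.1, one_kronecker_one]
  · have : diagonal (fun x : n × m => ((p x.1 * q x.2 : ℝ) : ℂ))
        = diagonal (fun i => (p i : ℂ)) ⊗ₖ diagonal (fun i => (q i : ℂ)) := by
      rw [diagonal_kronecker_diagonal]
      simp
    rw [this, conjTranspose_kronecker, ← mul_kronecker_mul, ← mul_kronecker_mul, ← h.2, ← h'.2]

theorem smul (h : Diagonalizes U p ρ) (c : ℝ) :
    Diagonalizes U (fun i => c * p i) ((c : ℂ) • ρ) := by
  refine ⟨h.1, ?_⟩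
  have : diagonal (fun i => ((c * p i : ℝ) : ℂ)) = (c : ℂ) • diagonal (fun i => (p i : ℂ)) := by
    rw [← diagonal_smul]
    congr 1
    ext i
    simp
  rw [this, Matrix.mul_smul, Matrix.smul_mul, ← h.2]

theorem blockDiagonal {U : m → Matrix n n ℂ} {p : m → n → ℝ} {ρ : m → Matrix n n ℂ}
    (h : ∀ c, Diagonalizes (U c) (p c) (ρ c)) :
    Diagonalizes (blockDiagonal U) (fun x => p x.2 x.1) (Matrix.blockDiagonal ρ) := by
  refine ⟨?_, ?_⟩
  · rw [blockDiagonal_conjTranspose, ← blockDiagonal_mul, ← blockDiagonal_one]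
    exact congrArg _ (funext fun c => (h c).1)
  · have : diagonal (fun x : n × m => ((p x.2 x.1 : ℝ) : ℂ))
        = Matrix.blockDiagonal (fun c => diagonal (fun i => (p c i : ℂ))) := by
      rw [blockDiagonal_diagonal]
    rw [this, blockDiagonal_conjTranspose, ← blockDiagonal_mul, ← blockDiagonal_mul]
    exact congrArg _ (funext fun c => (h c).2)

theorem trace_eq (h : Diagonalizes U p ρ) : ρ.trace = ((∑ i, p i : ℝ) : ℂ) := by
  rw [h.2, trace_mul_cycle, h.1, Matrix.one_mul, trace_diagonal]
  simp

end Diagonalizes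

theorem vnEntropy_submatrix {ρ : Matrix n n ℂ} (h : ρ.IsHermitian) (e : m ≃ n) :
    vnEntropy (ρ.submatrix e e) = vnEntropy ρ := by
  obtain ⟨U, p, hp⟩ := exists_diagonalizes h
  rw [hp.vnEntropy_eq, (hp.reindex e).vnEntropy_eq]
  exact e.sum_comp (fun i => Real.negMulLog (p i))

theorem vnEntropy_smul {ρ : Matrix n n ℂ} (h : ρ.IsHermitian) (c : ℝ) :
    vnEntropy ((c : ℂ) • ρ) = c * vnEntropy ρ + Real.negMulLog c * ρ.trace.re := by
  obtain ⟨U, p, hp⟩ := exists_diagonalizes h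
  rw [hp.vnEntropy_eq, (hp.smul c).vnEntropy_eq, hp.trace_eq, Complex.ofReal_re, Finset.mul_sum,
    Finset.mul_sum, ← Finset.sum_add_distrib]
  refine Finset.sum_congr rfl fun i _ => ?_
  rw [Real.negMulLog_mul]
  ring

theorem vnEntropy_blockDiagonal {ρ : m → Matrix n n ℂ} (h : ∀ c, (ρ c).IsHermitian) :
    vnEntropy (Matrix.blockDiagonal ρ) = ∑ c, vnEntropy (ρ c) := by
  choose U p hp using fun c => exists_diagonalizes (h c)
  rw [(Diagonalizes.blockDiagonal hp).vnEntropy_eq, Fintype.sum_prod_type_right]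
  exact Finset.sum_congr rfl fun c _ => ((hp c).vnEntropy_eq).symm

theorem vnEntropy_diagonal (p : n → ℝ) :
    vnEntropy (diagonal fun i => (p i : ℂ)) = ∑ i, Real.negMulLog (p i) :=
  Diagonalizes.vnEntropy_eq (U := 1) ⟨by simp, by simp⟩

end Diagonalization

/-! ### From resolvents to logarithms -/

section ScalarComparison

/-- The support condition matters at `R = 0`: a term with `q = 0` has zero weight, and otherwise the
logarithm stays away from its singularity. -/
theorem log_term_continuousOn {p q c : ℝ} (hp : 0 ≤ p) (hq : 0 ≤ q)
    (hsupp : q = 0 → c * p = 0) :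
    ContinuousOn (fun R => c * p * Real.log (R * p + q)) (Set.Ici 0) := by
  by_cases h : c * p = 0
  · simp only [h, zero_mul]
    exact continuousOn_const
  · have hq' : 0 < q := lt_of_le_of_ne hq fun h0 => h (hsupp h0.symm)
    refine ContinuousOn.mul continuousOn_const (ContinuousOn.log (by fun_prop) ?_)
    intro R hR
    have : 0 ≤ R * p := mul_nonneg hR hp
    positivity

theorem log_term_hasDerivAt {p q c R : ℝ} (hp : 0 ≤ p) (hq : 0 ≤ q) (hR : 0 < R)
    (hsupp : q = 0 → c * p = 0) :
    HasDerivAt (fun R => c * p * Real.log (R * p + q)) (c * (p ^ 2 / (R * p + q))) R := by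
  by_cases h : c * p = 0
  · have hz : c * (p ^ 2 / (R * p + q)) = 0 := by
      rw [sq, mul_div_assoc, ← mul_assoc, h, zero_mul]
    simp only [h, zero_mul, hz]
    exact hasDerivAt_const _ _
  · have hq' : 0 < q := lt_of_le_of_ne hq fun h0 => h (hsupp h0.symm)
    have hpos : R * p + q ≠ 0 := by positivity
    have h1 : HasDerivAt (fun R => R * p + q) p R := by
      simpa using ((hasDerivAt_id R).mul_const p).add_const q
    refine ((h1.log hpos).const_mul (c * p)).congr_deriv ?_
    ring

theorem log_term_tendsto {p q c : ℝ} (hp : 0 ≤ p) :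
    Tendsto (fun R => c * p * Real.log (R * p + q) - c * p * Real.log R) atTop
      (𝓝 (c * p * Real.log p)) := by
  by_cases h : p = 0
  · simp [h]
  · have hp' : 0 < p := lt_of_le_of_ne hp (Ne.symm h)
    have hlim : Tendsto (fun R : ℝ => p + q / R) atTop (𝓝 p) := by
      simpa using (tendsto_const_nhds (x := p)).add
        ((tendsto_const_nhds (x := q)).div_atTop tendsto_id)
    have hlog := ((Real.continuousAt_log h).tendsto.comp hlim).const_mul (c * p)
    refine hlog.congr' ?_
    filter_upwards [eventually_gt_atTop 0, hlim.eventually (lt_mem_nhds hp')] with R hR hRp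
    have : R * p + q = R * (p + q / R) := by field_simp
    simp only [Function.comp]
    rw [this, Real.log_mul hR.ne' hRp.ne']
    ring

variable {ι κ : Type*} [Fintype ι] [Fintype κ]

/-- If `∑ c' p'² / (t p' + q') ≤ ∑ c p² / (t p + q)` for all `t > 0`, then
`∑ c' p' log (p' / q') ≤ ∑ c p log (p / q)`. -/
theorem sum_log_le_of_resolvent_le {c p q : ι → ℝ} {c' p' q' : κ → ℝ}
    (hp : ∀ i, 0 ≤ p i) (hq : ∀ i, 0 ≤ q i) (hs : ∀ i, q i = 0 → c i * p i = 0)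
    (hp' : ∀ i, 0 ≤ p' i) (hq' : ∀ i, 0 ≤ q' i) (hs' : ∀ i, q' i = 0 → c' i * p' i = 0)
    (hmass : ∑ i, c i * p i = ∑ i, c' i * p' i)
    (h : ∀ t, 0 < t → ∑ i, c' i * (p' i ^ 2 / (t * p' i + q' i))
      ≤ ∑ i, c i * (p i ^ 2 / (t * p i + q i))) :
    ∑ i, c' i * p' i * (Real.log (p' i) - Real.log (q' i))
      ≤ ∑ i, c i * p i * (Real.log (p i) - Real.log (q i)) := by
  -- The derivative of `g` is the difference of the two resolvent sums, so `g` increases. Its value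
  -- at `0` carries the `log q` terms and its limit at infinity the `log p` terms; equal masses make
  -- the divergent `log R` cancel.
  set g : ℝ → ℝ := fun R => ∑ i, c i * p i * Real.log (R * p i + q i)
    - ∑ i, c' i * p' i * Real.log (R * p' i + q' i) with hg
  have hderiv : ∀ R, 0 < R → HasDerivAt g (∑ i, c i * (p i ^ 2 / (R * p i + q i))
      - ∑ i, c' i * (p' i ^ 2 / (R * p' i + q' i))) R := fun R hR =>
    (HasDerivAt.fun_sum fun i _ => log_term_hasDerivAt (hp i) (hq i) hR (hs i)).sub
      (HasDerivAt.fun_sum fun i _ => log_term_hasDerivAt (hp' i) (hq' i) hR (hs' i))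
  have hcont : ContinuousOn g (Set.Ici 0) :=
    (continuousOn_finsetSum _ fun i _ => log_term_continuousOn (hp i) (hq i) (hs i)).sub
      (continuousOn_finsetSum _ fun i _ => log_term_continuousOn (hp' i) (hq' i) (hs' i))
  have hmono : MonotoneOn g (Set.Ici 0) := by
    refine monotoneOn_of_deriv_nonneg (convex_Ici 0) hcont ?_ ?_
    · rw [interior_Ici]
      exact fun R hR => (hderiv R hR).differentiableAt.differentiableWithinAt
    · rw [interior_Ici]
      intro R hR
      rw [(hderiv R hR).deriv]
      exact sub_nonneg.mpr (h R hR)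
  have hlim : Tendsto g atTop (𝓝 (∑ i, c i * p i * Real.log (p i)
      - ∑ i, c' i * p' i * Real.log (p' i))) := by
    refine ((tendsto_finsetSum Finset.univ fun i _ => log_term_tendsto (c := c i) (q := q i)
      (hp i)).sub (tendsto_finsetSum Finset.univ fun i _ => log_term_tendsto (c := c' i)
      (q := q' i) (hp' i))).congr fun R => ?_
    rw [Finset.sum_sub_distrib, Finset.sum_sub_distrib, ← Finset.sum_mul, ← Finset.sum_mul, hmass]
    simp only [hg]
    ring
  have hle := ge_of_tendsto hlim (b := g 0) (by
    filter_upwards [eventually_ge_atTop 0] with R hR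
    exact hmono Set.self_mem_Ici hR hR)
  simp only [hg, zero_mul, zero_add] at hle
  simp only [mul_sub, Finset.sum_sub_distrib]
  linarith

end ScalarComparison

/-! ### Variational formula for the resolvent and comparison of relative entropies -/

section Variational

variable {n m : Type*} [Fintype n] [DecidableEq n] [Fintype m] [DecidableEq m]

/-- The functional `2 Re Tr Xρ - t Tr XρX† - Tr X†σX`; its supremum over `X` is
`Tr ρ (t R_ρ + L_σ)⁻¹ ρ`, where `R_ρ` and `L_σ` are right and left multiplication. -/
def resolventFunctional (t : ℝ) (ρ σ X : Matrix n n ℂ) : ℝ :=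
  2 * (X * ρ).trace.re - t * (Xᴴ * X * ρ).trace.re - (X * Xᴴ * σ).trace.re

variable {U V ρ σ : Matrix n n ℂ} {p q : n → ℝ}

theorem resolventFunctional_eq (hρ : Diagonalizes U p ρ) (hσ : Diagonalizes V q σ) (t : ℝ)
    (Y : Matrix n n ℂ) :
    resolventFunctional t ρ σ (V * Y * Uᴴ) = ∑ i, ∑ j,
      (2 * p i * ((Uᴴ * V) i j * Y j i).re - (t * p i + q j) * Complex.normSq (Y j i)) := by
  have h1 : (V * Y * Uᴴ * ρ).trace
      = ∑ i, ∑ j, (Uᴴ * V) i j * Y j i * (p i : ℂ) := by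
    have : (V * Y * Uᴴ * ρ).trace = ((Uᴴ * V) * Y * (Uᴴ * ρ * U)).trace := by
      rw [trace_mul_comm _ (Uᴴ * ρ * U)]
      have h2 : Uᴴ * ρ * U * (Uᴴ * V * Y) = Uᴴ * (ρ * (V * Y)) := by
        have := hρ.mul_conjTranspose
        calc Uᴴ * ρ * U * (Uᴴ * V * Y) = Uᴴ * ρ * (U * Uᴴ) * V * Y := by
              simp only [Matrix.mul_assoc]
          _ = _ := by rw [this]; simp only [Matrix.mul_assoc, Matrix.one_mul]
      rw [h2, trace_mul_comm Uᴴ, trace_mul_comm _ ρ]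
      simp only [Matrix.mul_assoc]
    rw [this, hρ.conj_eq_diagonal, trace]
    simp only [diag_apply, mul_diagonal, mul_apply (M := Uᴴ * V), Finset.sum_mul]
  have h2 : ((V * Y * Uᴴ)ᴴ * (V * Y * Uᴴ) * ρ).trace
      = ∑ i, ∑ j, (Complex.normSq (Y j i) : ℂ) * (p i : ℂ) := by
    have : ((V * Y * Uᴴ)ᴴ * (V * Y * Uᴴ) * ρ).trace = (Yᴴ * Y * (Uᴴ * ρ * U)).trace := by
      have h3 : (V * Y * Uᴴ)ᴴ * (V * Y * Uᴴ) * ρ = U * (Yᴴ * Y * (Uᴴ * ρ)) := by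
        simp only [conjTranspose_mul, conjTranspose_conjTranspose]
        calc U * (Yᴴ * Vᴴ) * (V * Y * Uᴴ) * ρ = U * Yᴴ * (Vᴴ * V) * Y * Uᴴ * ρ := by
              simp only [Matrix.mul_assoc]
          _ = _ := by rw [hσ.1]; simp only [Matrix.mul_assoc, Matrix.mul_one]
      rw [h3, trace_mul_comm]
      simp only [Matrix.mul_assoc]
    rw [this, hρ.conj_eq_diagonal, trace]
    simp only [diag_apply, mul_diagonal, mul_apply (M := Yᴴ), Finset.sum_mul,
      conjTranspose_apply, Complex.normSq_eq_conj_mul_self]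
    rfl
  have h3 : ((V * Y * Uᴴ) * (V * Y * Uᴴ)ᴴ * σ).trace
      = ∑ i, ∑ j, (Complex.normSq (Y j i) : ℂ) * (q j : ℂ) := by
    have : ((V * Y * Uᴴ) * (V * Y * Uᴴ)ᴴ * σ).trace = (Y * Yᴴ * (Vᴴ * σ * V)).trace := by
      have h3 : (V * Y * Uᴴ) * (V * Y * Uᴴ)ᴴ * σ = V * (Y * Yᴴ * (Vᴴ * σ)) := by
        simp only [conjTranspose_mul, conjTranspose_conjTranspose]
        calc V * Y * Uᴴ * (U * (Yᴴ * Vᴴ)) * σ = V * Y * (Uᴴ * U) * Yᴴ * Vᴴ * σ := by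
              simp only [Matrix.mul_assoc]
          _ = _ := by rw [hρ.1]; simp only [Matrix.mul_assoc, Matrix.mul_one]
      rw [h3, trace_mul_comm]
      simp only [Matrix.mul_assoc]
    rw [this, hσ.conj_eq_diagonal, trace, Finset.sum_comm]
    simp only [diag_apply, mul_diagonal, mul_apply (M := Y), Finset.sum_mul,
      conjTranspose_apply, ← Complex.mul_conj]
    rfl
  rw [resolventFunctional, h1, h2, h3]
  simp only [Complex.re_sum, Complex.re_mul_ofReal, Complex.ofReal_re, Finset.mul_sum,
    ← Finset.sum_sub_distrib]
  refine Finset.sum_congr rfl fun i _ => Finset.sum_congr rfl fun j _ => ?_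
  ring

/-- The value of the supremum of `resolventFunctional` in spectral coordinates. -/
def resolventValue (U V : Matrix n n ℂ) (p q : n → ℝ) (t : ℝ) : ℝ :=
  ∑ i, ∑ j, Complex.normSq ((Uᴴ * V) i j) * (p i ^ 2 / (t * p i + q j))

/-- In the eigenbases the functional decouples into scalar concave quadratics, one for each matrix
entry, and completing the square bounds each of them. -/
theorem resolventFunctional_le (hρ : Diagonalizes U p ρ) (hσ : Diagonalizes V q σ)
    (hp : ∀ i, 0 ≤ p i) (hq : ∀ i, 0 ≤ q i) {t : ℝ} (ht : 0 < t) (X : Matrix n n ℂ) :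
    resolventFunctional t ρ σ X ≤ resolventValue U V p q t := by
  have hX : X = V * (Vᴴ * X * U) * Uᴴ := by
    calc X = (V * Vᴴ) * X * (U * Uᴴ) := by
          rw [hρ.mul_conjTranspose, hσ.mul_conjTranspose, Matrix.one_mul, Matrix.mul_one]
      _ = _ := by simp only [Matrix.mul_assoc]
  rw [hX, resolventFunctional_eq hρ hσ]
  refine Finset.sum_le_sum fun i _ => Finset.sum_le_sum fun j _ => ?_
  generalize (Vᴴ * X * U) j i = y
  generalize (Uᴴ * V) i j = w
  have hre : (w * y).re ≤ √(Complex.normSq w) * √(Complex.normSq y) := by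
    rw [← Real.sqrt_mul (Complex.normSq_nonneg _), ← Complex.normSq_mul]
    exact (Complex.re_le_norm _)
  have hw := Real.sq_sqrt (Complex.normSq_nonneg w)
  have hy := Real.sq_sqrt (Complex.normSq_nonneg y)
  rw [← hw, ← hy]
  generalize √(Complex.normSq w) = a at *
  generalize √(Complex.normSq y) = b at *
  have hb : 2 * p i * (w * y).re ≤ 2 * p i * (a * b) :=
    mul_le_mul_of_nonneg_left hre (by linarith [hp i])
  rcases (add_nonneg (mul_nonneg ht.le (hp i)) (hq j)).eq_or_lt with h0 | h0
  · have hpi : p i = 0 := by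
      have h1 := mul_nonneg ht.le (hp i)
      have h2 : t * p i = 0 := by linarith [hq j]
      exact (mul_eq_zero.mp h2).resolve_left ht.ne'
    rw [← h0, hpi]
    simp
  · have : a ^ 2 * (p i ^ 2 / (t * p i + q j))
        - (2 * p i * (a * b) - (t * p i + q j) * b ^ 2)
        = (a * p i - (t * p i + q j) * b) ^ 2 / (t * p i + q j) := by
      generalize t * p i + q j = s at h0
      field_simp
      ring
    have h2 : 0 ≤ (a * p i - (t * p i + q j) * b) ^ 2 / (t * p i + q j) := by positivity
    linarith

theorem exists_resolventFunctional_eq (hρ : Diagonalizes U p ρ) (hσ : Diagonalizes V q σ)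
    (t : ℝ) : ∃ X, resolventFunctional t ρ σ X = resolventValue U V p q t := by
  -- This is the entrywise maximizer of those quadratics. Where `t * p i + q j = 0`, division by
  -- zero makes both sides vanish.
  refine ⟨V * (of fun j i => star ((Uᴴ * V) i j) * ((p i / (t * p i + q j) : ℝ) : ℂ)) * Uᴴ, ?_⟩
  rw [resolventFunctional_eq hρ hσ]
  refine Finset.sum_congr rfl fun i _ => Finset.sum_congr rfl fun j _ => ?_
  rw [of_apply]
  generalize (Uᴴ * V) i j = w
  rw [← mul_assoc, Complex.star_def, Complex.mul_conj, ← Complex.ofReal_mul, Complex.ofReal_re,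
    Complex.normSq_mul, Complex.normSq_conj, Complex.normSq_ofReal]
  by_cases h0 : t * p i + q j = 0
  · simp [h0]
  · field_simp
    ring

variable {U' V' ρ' σ' : Matrix m m ℂ} {p' q' : m → ℝ}

/-- `-Tr ρ log σ` for `σ = V diag(q) V†`. -/
def crossEntropy (V : Matrix n n ℂ) (q : n → ℝ) (ρ : Matrix n n ℂ) : ℝ :=
  -∑ j, Real.log (q j) * ((Vᴴ * ρ * V) j j).re

theorem re_conj_diag_eq (hρ : Diagonalizes U p ρ) (V : Matrix n n ℂ) (j : n) :
    ((Vᴴ * ρ * V) j j).re = ∑ i, Complex.normSq ((Uᴴ * V) i j) * p i := by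
  have : Vᴴ * ρ * V = (Uᴴ * V)ᴴ * (diagonal (fun i => (p i : ℂ)) * (Uᴴ * V)) := by
    rw [hρ.2, conjTranspose_mul, conjTranspose_conjTranspose]
    simp only [Matrix.mul_assoc]
  rw [this, mul_apply, Complex.re_sum]
  refine Finset.sum_congr rfl fun i _ => ?_
  rw [diagonal_mul, conjTranspose_apply, mul_left_comm, Complex.star_def,
    ← Complex.normSq_eq_conj_mul_self, ← Complex.ofReal_mul, Complex.ofReal_re, mul_comm]

theorem sum_normSq_row (hρ : Diagonalizes U p ρ) (hσ : Diagonalizes V q σ) (i : n) :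
    ∑ j, Complex.normSq ((Uᴴ * V) i j) = 1 := by
  have h : (Uᴴ * V) * (Uᴴ * V)ᴴ = 1 := by
    rw [conjTranspose_mul, conjTranspose_conjTranspose]
    calc Uᴴ * V * (Vᴴ * U) = Uᴴ * (V * Vᴴ) * U := by simp only [Matrix.mul_assoc]
      _ = 1 := by rw [hσ.mul_conjTranspose, Matrix.mul_one, hρ.1]
  have h2 := congrFun (congrFun h i) i
  rw [mul_apply, one_apply_eq] at h2
  simp only [conjTranspose_apply, Complex.star_def, Complex.mul_conj] at h2
  exact_mod_cast h2

theorem sum_log_eq_crossEntropy_sub (hρ : Diagonalizes U p ρ) (hσ : Diagonalizes V q σ) :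
    ∑ x : n × n, Complex.normSq ((Uᴴ * V) x.1 x.2) * p x.1 * (Real.log (p x.1) - Real.log (q x.2))
      = crossEntropy V q ρ - vnEntropy ρ := by
  have h1 : ∑ i, ∑ j, Complex.normSq ((Uᴴ * V) i j) * p i * Real.log (p i) = -vnEntropy ρ := by
    rw [hρ.vnEntropy_eq, ← Finset.sum_neg_distrib]
    refine Finset.sum_congr rfl fun i _ => ?_
    simp only [mul_assoc]
    rw [← Finset.sum_mul, sum_normSq_row hρ hσ, Real.negMulLog]
    ring
  have h2 : ∑ i, ∑ j, Complex.normSq ((Uᴴ * V) i j) * p i * Real.log (q j)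
      = -crossEntropy V q ρ := by
    rw [crossEntropy, neg_neg, Finset.sum_comm]
    refine Finset.sum_congr rfl fun j _ => ?_
    rw [re_conj_diag_eq hρ, ← Finset.sum_mul, mul_comm]
  rw [Fintype.sum_prod_type]
  simp only [mul_sub, Finset.sum_sub_distrib]
  rw [h1, h2]
  ring

/-- The inclusion of supports, read entrywise: a sum of nonnegative terms vanishes only termwise. It
makes the convention `log 0 = 0` harmless. -/
theorem overlap_eq_zero (hρ : Diagonalizes U p ρ) (pρ : ρ.PosSemidef)
    (hs : ∀ j, q j = 0 → ((Vᴴ * ρ * V) j j).re = 0) (x : n × n) (hx : q x.2 = 0) :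
    Complex.normSq ((Uᴴ * V) x.1 x.2) * p x.1 = 0 := by
  have h1 := hs x.2 hx
  rw [re_conj_diag_eq hρ, Finset.sum_eq_zero_iff_of_nonneg
    (fun i _ => mul_nonneg (Complex.normSq_nonneg _) (hρ.nonneg pρ i))] at h1
  exact h1 x.1 (Finset.mem_univ _)

theorem sum_overlap (hρ : Diagonalizes U p ρ) (hσ : Diagonalizes V q σ) :
    ∑ x : n × n, Complex.normSq ((Uᴴ * V) x.1 x.2) * p x.1 = ρ.trace.re := by
  rw [Fintype.sum_prod_type, hρ.trace_eq, Complex.ofReal_re]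
  refine Finset.sum_congr rfl fun i _ => ?_
  dsimp only
  rw [← Finset.sum_mul, sum_normSq_row hρ hσ, one_mul]

/-- A comparison principle for the relative entropies `Tr ρ (log ρ - log σ)`, which gives
their monotonicity under quantum operations. -/
theorem crossEntropy_sub_vnEntropy_le (hρ : Diagonalizes U p ρ) (hσ : Diagonalizes V q σ)
    (hρ' : Diagonalizes U' p' ρ') (hσ' : Diagonalizes V' q' σ')
    (pρ : ρ.PosSemidef) (pσ : σ.PosSemidef) (pρ' : ρ'.PosSemidef) (pσ' : σ'.PosSemidef)
    (hs : ∀ j, q j = 0 → ((Vᴴ * ρ * V) j j).re = 0)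
    (hs' : ∀ j, q' j = 0 → ((V'ᴴ * ρ' * V') j j).re = 0)
    (htr : ρ.trace = ρ'.trace)
    (h : ∀ t, 0 < t → ∀ X', ∃ X, resolventFunctional t ρ' σ' X' ≤ resolventFunctional t ρ σ X) :
    crossEntropy V' q' ρ' - vnEntropy ρ' ≤ crossEntropy V q ρ - vnEntropy ρ := by
  rw [← sum_log_eq_crossEntropy_sub hρ hσ, ← sum_log_eq_crossEntropy_sub hρ' hσ']
  refine sum_log_le_of_resolvent_le (fun x => hρ.nonneg pρ x.1) (fun x => hσ.nonneg pσ x.2)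
    (overlap_eq_zero hρ pρ hs) (fun x => hρ'.nonneg pρ' x.1) (fun x => hσ'.nonneg pσ' x.2)
    (overlap_eq_zero hρ' pρ' hs') ?_ ?_
  · rw [sum_overlap hρ hσ, sum_overlap hρ' hσ', htr]
  · intro t ht
    rw [Fintype.sum_prod_type, Fintype.sum_prod_type]
    -- It suffices that the supremum is attained on the primed side and is an upper bound on the
    -- other.
    obtain ⟨X', hX'⟩ := exists_resolventFunctional_eq hρ' hσ' t
    obtain ⟨X, hX⟩ := h t ht X'
    exact hX'.symm.le.trans (hX.trans (resolventFunctional_le hρ hσ (hρ.nonneg pρ)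
      (hσ.nonneg pσ) ht X))

end Variational

/-! ### Monotonicity of mutual information under partial trace -/

section PartialTrace

set_option linter.unusedSectionVars false

variable {A B A₁ A₂ B₁ B₂ : Type*} [Fintype A] [DecidableEq A] [Fintype B] [DecidableEq B]
  [Fintype A₁] [DecidableEq A₁] [Fintype A₂] [DecidableEq A₂]
  [Fintype B₁] [DecidableEq B₁] [Fintype B₂] [DecidableEq B₂]

theorem traceSnd_posSemidef {ρ : Matrix (A × B) (A × B) ℂ} (h : ρ.PosSemidef) :
    (traceSnd ρ).PosSemidef := by
  have : traceSnd ρ = ∑ b, ρ.submatrix (fun a => (a, b)) (fun a => (a, b)) := by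
    ext a a'
    simp [traceSnd, Matrix.sum_apply]
  rw [this]
  exact posSemidef_sum _ fun b _ => h.submatrix _

theorem traceFst_eq_traceSnd_swap (ρ : Matrix (A × B) (A × B) ℂ) :
    traceFst ρ = traceSnd (ρ.submatrix Prod.swap Prod.swap) := rfl

theorem traceFst_posSemidef {ρ : Matrix (A × B) (A × B) ℂ} (h : ρ.PosSemidef) :
    (traceFst ρ).PosSemidef :=
  traceSnd_posSemidef (h.submatrix Prod.swap)

/-- Partial trace is the adjoint of `X ↦ X ⊗ 1`; the identities below follow by testing against such
matrices. -/
theorem trace_kronecker_one_mul (X : Matrix A A ℂ) (ρ : Matrix (A × B) (A × B) ℂ) :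
    ((X ⊗ₖ (1 : Matrix B B ℂ)) * ρ).trace = (X * traceSnd ρ).trace := by
  simp only [trace, diag_apply, mul_apply, kronecker_apply, one_apply, traceSnd,
    Fintype.sum_prod_type, mul_ite, mul_one, mul_zero, ite_mul, zero_mul,
    Finset.sum_ite_eq, Finset.mem_univ, if_true, Finset.mul_sum]
  exact Finset.sum_congr rfl fun a _ => Finset.sum_comm

theorem trace_traceSnd (ρ : Matrix (A × B) (A × B) ℂ) : (traceSnd ρ).trace = ρ.trace := by
  have := trace_kronecker_one_mul (1 : Matrix A A ℂ) ρ
  rwa [one_kronecker_one, Matrix.one_mul, Matrix.one_mul, eq_comm] at this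

theorem traceSnd_conj_kronecker (U : Matrix A A ℂ) {V : Matrix B B ℂ} (hV : V * Vᴴ = 1)
    (ρ : Matrix (A × B) (A × B) ℂ) :
    traceSnd ((U ⊗ₖ V)ᴴ * ρ * (U ⊗ₖ V)) = Uᴴ * traceSnd ρ * U := by
  rw [ext_iff_trace_mul_left]
  intro X
  have h1 : (X * (Uᴴ * traceSnd ρ * U)).trace = (U * X * Uᴴ * traceSnd ρ).trace := by
    rw [← Matrix.mul_assoc, trace_mul_comm]
    simp only [Matrix.mul_assoc]
  have h2 : (U * X * Uᴴ) ⊗ₖ (1 : Matrix B B ℂ) = (U ⊗ₖ V) * (X ⊗ₖ 1) * (U ⊗ₖ V)ᴴ := by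
    rw [conjTranspose_kronecker, ← mul_kronecker_mul, ← mul_kronecker_mul, Matrix.mul_one, hV]
  rw [h1, ← trace_kronecker_one_mul, ← trace_kronecker_one_mul, h2, ← Matrix.mul_assoc,
    trace_mul_comm]
  simp only [Matrix.mul_assoc]

theorem traceFst_conj_kronecker {U : Matrix A A ℂ} (hU : U * Uᴴ = 1) (V : Matrix B B ℂ)
    (ρ : Matrix (A × B) (A × B) ℂ) :
    traceFst ((U ⊗ₖ V)ᴴ * ρ * (U ⊗ₖ V)) = Vᴴ * traceFst ρ * V := by
  have hswap : (U ⊗ₖ V).submatrix (Equiv.prodComm B A) (Equiv.prodComm B A) = V ⊗ₖ U := by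
    ext x y
    exact mul_comm _ _
  rw [traceFst_eq_traceSnd_swap, traceFst_eq_traceSnd_swap, ← traceSnd_conj_kronecker V hU,
    ← hswap, conjTranspose_submatrix]
  exact congrArg traceSnd (by
    rw [← Equiv.coe_prodComm, ← submatrix_mul_equiv _ _ _ (Equiv.prodComm B A),
      ← submatrix_mul_equiv _ _ _ (Equiv.prodComm B A)])

/-- The heart of monotonicity: `X ↦ X ⊗ 1` respects products and adjoints, so every term of the
functional only sees the reduced states. -/
theorem resolventFunctional_kronecker_one (t : ℝ) (ρ σ : Matrix (A × B) (A × B) ℂ)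
    (X : Matrix A A ℂ) :
    resolventFunctional t ρ σ (X ⊗ₖ 1) = resolventFunctional t (traceSnd ρ) (traceSnd σ) X := by
  simp only [resolventFunctional, conjTranspose_kronecker, conjTranspose_one, ← mul_kronecker_mul,
    Matrix.one_mul, trace_kronecker_one_mul]

theorem resolventFunctional_submatrix (t : ℝ) (ρ σ X : Matrix A A ℂ) (e : B ≃ A) :
    resolventFunctional t (ρ.submatrix e e) (σ.submatrix e e) (X.submatrix e e)
      = resolventFunctional t ρ σ X := by
  have htr : ∀ Z : Matrix A A ℂ, (Z.submatrix e e).trace = Z.trace := fun Z =>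
    e.sum_comp fun i => Z i i
  simp only [resolventFunctional, conjTranspose_submatrix, submatrix_mul_equiv, htr]

/-! ### Mutual information as a relative entropy -/

variable {ρ : Matrix (A × B) (A × B) ℂ} {U : Matrix A A ℂ} {V : Matrix B B ℂ}
  {α : A → ℝ} {β : B → ℝ}

theorem sum_re_conj_diag_snd (hA : Diagonalizes U α (traceSnd ρ)) (hV : V * Vᴴ = 1) (a : A) :
    ∑ b, (((U ⊗ₖ V)ᴴ * ρ * (U ⊗ₖ V)) (a, b) (a, b)).re = α a := by
  have h := congrFun (congrFun (traceSnd_conj_kronecker U hV ρ) a) a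
  rw [hA.conj_eq_diagonal, diagonal_apply_eq] at h
  rw [← Complex.re_sum]
  exact (congrArg Complex.re h).trans (Complex.ofReal_re _)

theorem sum_re_conj_diag_fst (hB : Diagonalizes V β (traceFst ρ)) (hU : U * Uᴴ = 1) (b : B) :
    ∑ a, (((U ⊗ₖ V)ᴴ * ρ * (U ⊗ₖ V)) (a, b) (a, b)).re = β b := by
  have h := congrFun (congrFun (traceFst_conj_kronecker hU V ρ) b) b
  rw [hB.conj_eq_diagonal, diagonal_apply_eq] at h
  rw [← Complex.re_sum]
  exact (congrArg Complex.re h).trans (Complex.ofReal_re _)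

/-- The support of `ρ` lies in that of the product of its marginals: the nonnegative diagonal
entries of `ρ` in a row or column sum to a marginal eigenvalue. -/
theorem re_conj_diag_eq_zero (hρ : ρ.PosSemidef) (hA : Diagonalizes U α (traceSnd ρ))
    (hB : Diagonalizes V β (traceFst ρ)) (x : A × B) (hx : α x.1 * β x.2 = 0) :
    (((U ⊗ₖ V)ᴴ * ρ * (U ⊗ₖ V)) x x).re = 0 := by
  have hnn : ∀ y, 0 ≤ (((U ⊗ₖ V)ᴴ * ρ * (U ⊗ₖ V)) y y).re := fun y =>
    (Complex.le_def.mp (hρ.conjTranspose_mul_mul_same (U ⊗ₖ V)).diag_nonneg).1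
  rcases mul_eq_zero.mp hx with h | h
  · have h1 := sum_re_conj_diag_snd hA hB.mul_conjTranspose x.1
    rw [h, Finset.sum_eq_zero_iff_of_nonneg fun b _ => hnn _] at h1
    exact h1 x.2 (Finset.mem_univ _)
  · have h1 := sum_re_conj_diag_fst hB hA.mul_conjTranspose x.2
    rw [h, Finset.sum_eq_zero_iff_of_nonneg fun b _ => hnn _] at h1
    exact h1 x.1 (Finset.mem_univ _)

/-- `I(A;B) = -Tr ρ log (ρ_A ⊗ ρ_B) - H(ρ)`. -/
theorem mutualInfo_eq_crossEntropy (hρ : ρ.PosSemidef) (hA : Diagonalizes U α (traceSnd ρ))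
    (hB : Diagonalizes V β (traceFst ρ)) :
    mutualInfo ρ = crossEntropy (U ⊗ₖ V) (fun x => α x.1 * β x.2) ρ - vnEntropy ρ := by
  have hlog : ∀ x : A × B,
      Real.log (α x.1 * β x.2) * (((U ⊗ₖ V)ᴴ * ρ * (U ⊗ₖ V)) x x).re
        = Real.log (α x.1) * (((U ⊗ₖ V)ᴴ * ρ * (U ⊗ₖ V)) x x).re
          + Real.log (β x.2) * (((U ⊗ₖ V)ᴴ * ρ * (U ⊗ₖ V)) x x).re := by
    intro x
    by_cases h : α x.1 * β x.2 = 0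
    · simp [re_conj_diag_eq_zero hρ hA hB x h]
    · rw [Real.log_mul (left_ne_zero_of_mul h) (right_ne_zero_of_mul h), add_mul]
  rw [mutualInfo, crossEntropy, hA.vnEntropy_eq, hB.vnEntropy_eq]
  simp only [hlog, Finset.sum_add_distrib]
  rw [Fintype.sum_prod_type, Fintype.sum_prod_type_right (f := fun x : A × B =>
    Real.log (β x.2) * (((U ⊗ₖ V)ᴴ * ρ * (U ⊗ₖ V)) x x).re)]
  simp only [← Finset.mul_sum, sum_re_conj_diag_snd hA hB.mul_conjTranspose,
    sum_re_conj_diag_fst hB hA.mul_conjTranspose, Real.negMulLog, neg_mul,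
    Finset.sum_neg_distrib, mul_comm (α _), mul_comm (β _)]
  ring

theorem traceSnd_kronecker_prodComm (R : Matrix (A₁ × A₂) (A₁ × A₂) ℂ)
    (S : Matrix (B₁ × B₂) (B₁ × B₂) ℂ) :
    traceSnd ((R ⊗ₖ S).submatrix (Equiv.prodProdProdComm A₁ B₁ A₂ B₂)
      (Equiv.prodProdProdComm A₁ B₁ A₂ B₂)) = traceSnd R ⊗ₖ traceSnd S := by
  ext x y
  simp only [traceSnd, submatrix_apply, kronecker_apply, Fintype.sum_prod_type,
    Equiv.prodProdProdComm_apply]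
  exact (Finset.sum_mul_sum _ _ _ _).symm

theorem traceSnd_traceSnd_prodComm
    (ρ : Matrix ((A₁ × A₂) × (B₁ × B₂)) ((A₁ × A₂) × (B₁ × B₂)) ℂ) :
    traceSnd (traceSnd (ρ.submatrix (Equiv.prodProdProdComm A₁ B₁ A₂ B₂)
      (Equiv.prodProdProdComm A₁ B₁ A₂ B₂))) = traceSnd (traceSnd ρ) := by
  ext x y
  simp only [traceSnd, submatrix_apply, Fintype.sum_prod_type, Equiv.prodProdProdComm_apply]
  exact Finset.sum_comm

theorem traceFst_traceSnd_prodComm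
    (ρ : Matrix ((A₁ × A₂) × (B₁ × B₂)) ((A₁ × A₂) × (B₁ × B₂)) ℂ) :
    traceFst (traceSnd (ρ.submatrix (Equiv.prodProdProdComm A₁ B₁ A₂ B₂)
      (Equiv.prodProdProdComm A₁ B₁ A₂ B₂))) = traceSnd (traceFst ρ) := by
  ext x y
  simp only [traceSnd, traceFst, submatrix_apply, Fintype.sum_prod_type,
    Equiv.prodProdProdComm_apply]
  symm
  rw [Finset.sum_comm]
  exact Finset.sum_congr rfl fun a _ => Finset.sum_comm

/-- The mutual information does not increase when parts of both systems are discarded. -/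
theorem mutualInfo_traceSnd_le {ρ : Matrix ((A₁ × A₂) × (B₁ × B₂)) ((A₁ × A₂) × (B₁ × B₂)) ℂ}
    (hρ : ρ.PosSemidef) :
    mutualInfo (traceSnd (ρ.submatrix (Equiv.prodProdProdComm A₁ B₁ A₂ B₂)
      (Equiv.prodProdProdComm A₁ B₁ A₂ B₂))) ≤ mutualInfo ρ := by
  set e := Equiv.prodProdProdComm A₁ B₁ A₂ B₂
  set ρ' := traceSnd (ρ.submatrix e e) with hρ'
  have pρ' : ρ'.PosSemidef := traceSnd_posSemidef (hρ.submatrix e)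
  have pA := traceSnd_posSemidef hρ
  have pB := traceFst_posSemidef hρ
  have pA' := traceSnd_posSemidef pρ'
  have pB' := traceFst_posSemidef pρ'
  obtain ⟨U, α, hA⟩ := exists_diagonalizes pA.isHermitian
  obtain ⟨V, β, hB⟩ := exists_diagonalizes pB.isHermitian
  obtain ⟨U', α', hA'⟩ := exists_diagonalizes pA'.isHermitian
  obtain ⟨V', β', hB'⟩ := exists_diagonalizes pB'.isHermitian
  obtain ⟨W, p, hW⟩ := exists_diagonalizes hρ.isHermitian
  obtain ⟨W', p', hW'⟩ := exists_diagonalizes pρ'.isHermitian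
  rw [mutualInfo_eq_crossEntropy hρ hA hB, mutualInfo_eq_crossEntropy pρ' hA' hB']
  refine crossEntropy_sub_vnEntropy_le hW (hA.kronecker hB) hW' (hA'.kronecker hB') hρ
    (pA.kronecker pB) pρ' (pA'.kronecker pB') (re_conj_diag_eq_zero hρ hA hB)
    (re_conj_diag_eq_zero pρ' hA' hB') ?_ ?_
  · rw [hρ', trace_traceSnd]
    exact (e.sum_comp fun i => ρ i i).symm
  · intro t _ X
    -- The permutation `e` gathers the kept factors on the left, where the test matrix is extended
    -- by the identity.
    refine ⟨(X ⊗ₖ 1).submatrix e.symm e.symm, le_of_eq ?_⟩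
    rw [← resolventFunctional_submatrix t _ _ _ e, submatrix_submatrix, Equiv.symm_comp_self,
      submatrix_id_id, resolventFunctional_kronecker_one]
    rw [traceSnd_kronecker_prodComm, hρ', traceSnd_traceSnd_prodComm, traceFst_traceSnd_prodComm]

theorem vnEntropy_unit {σ : Matrix Unit Unit ℂ} (h : σ.IsHermitian) :
    vnEntropy σ = Real.negMulLog (σ () ()).re := by
  have hσ : σ = diagonal fun i => ((σ i i).re : ℂ) := by
    ext i j
    rw [Subsingleton.elim j i, diagonal_apply_eq]
    exact (h.coe_re_apply_self i).symm
  conv_lhs => rw [hσ]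
  rw [vnEntropy_diagonal]
  simp

theorem mutualInfo_unit {ρ : Matrix (Unit × Unit) (Unit × Unit) ℂ} (hρ : ρ.PosSemidef) :
    mutualInfo ρ = Real.negMulLog ρ.trace.re := by
  have h1 : vnEntropy ρ = Real.negMulLog ρ.trace.re := by
    rw [← vnEntropy_submatrix hρ.isHermitian (Equiv.prodUnique Unit Unit).symm, vnEntropy_unit
      (hρ.isHermitian.submatrix _)]
    simp [trace, Fintype.sum_prod_type]
  rw [mutualInfo, h1, vnEntropy_unit (traceSnd_posSemidef hρ).isHermitian,
    vnEntropy_unit (traceFst_posSemidef hρ).isHermitian]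
  simp [traceSnd, traceFst, trace, Fintype.sum_prod_type]

theorem mutualInfo_submatrix (hρ : ρ.PosSemidef) (e : A₁ ≃ A) (f : B₁ ≃ B) :
    mutualInfo (ρ.submatrix (e.prodCongr f) (e.prodCongr f)) = mutualInfo ρ := by
  have h1 : traceSnd (ρ.submatrix (e.prodCongr f) (e.prodCongr f))
      = (traceSnd ρ).submatrix e e := by
    ext x y
    exact f.sum_comp fun b => ρ (e x, b) (e y, b)
  have h2 : traceFst (ρ.submatrix (e.prodCongr f) (e.prodCongr f))
      = (traceFst ρ).submatrix f f := by
    ext x y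
    exact e.sum_comp fun a => ρ (a, f x) (a, f y)
  rw [mutualInfo, mutualInfo, h1, h2, vnEntropy_submatrix hρ.isHermitian,
    vnEntropy_submatrix (traceSnd_posSemidef hρ).isHermitian,
    vnEntropy_submatrix (traceFst_posSemidef hρ).isHermitian]

/-- Discarding both systems leaves a scalar, whose mutual information is `negMulLog` of the trace.
Trace below `1` is allowed because the state is zero when `M = 0`. -/
theorem mutualInfo_nonneg (hρ : ρ.PosSemidef) (htr : ρ.trace.re ≤ 1) : 0 ≤ mutualInfo ρ := by
  set f := (Equiv.uniqueProd A Unit).prodCongr (Equiv.uniqueProd B Unit)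
  have pf : (ρ.submatrix f f).PosSemidef := hρ.submatrix f
  rw [← mutualInfo_submatrix hρ (Equiv.uniqueProd A Unit) (Equiv.uniqueProd B Unit)]
  refine le_trans ?_ (mutualInfo_traceSnd_le pf)
  rw [mutualInfo_unit (traceSnd_posSemidef (pf.submatrix _)), trace_traceSnd]
  have : ((ρ.submatrix f f).submatrix (Equiv.prodProdProdComm Unit Unit A B)
      (Equiv.prodProdProdComm Unit Unit A B)).trace = ρ.trace :=
    ((Equiv.prodProdProdComm Unit Unit A B).trans f).sum_comp fun i => ρ i i
  rw [this]
  exact Real.negMulLog_nonneg (Complex.le_def.mp hρ.trace_nonneg).1 htr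

/-- `I(A;B) ≤ log c` if `ρ ≤ c ρ_A ⊗ ρ_B`. -/
theorem mutualInfo_le_log {c : ℝ} (hc : 0 < c) (hρ : ρ.PosSemidef) (htr : ρ.trace = 1)
    (h : ((traceSnd ρ ⊗ₖ traceFst ρ) - ((c⁻¹ : ℝ) : ℂ) • ρ).PosSemidef) :
    mutualInfo ρ ≤ Real.log c := by
  have pA := traceSnd_posSemidef hρ
  have pB := traceFst_posSemidef hρ
  obtain ⟨U, α, hA⟩ := exists_diagonalizes pA.isHermitian
  obtain ⟨V, β, hB⟩ := exists_diagonalizes pB.isHermitian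
  obtain ⟨W, p, hW⟩ := exists_diagonalizes hρ.isHermitian
  have hc' : 0 < c⁻¹ := inv_pos.mpr hc
  have hdiag : ∀ j, ((Wᴴ * ρ * W) j j).re = p j := fun j => by
    rw [hW.conj_eq_diagonal, diagonal_apply_eq, Complex.ofReal_re]
  have hsum : ∑ j, p j = 1 := by
    have := hW.trace_eq
    rw [htr] at this
    exact_mod_cast this.symm
  -- The relative entropy of `ρ` to `c⁻¹ ρ` is `log c`; it remains to replace `c⁻¹ ρ` by the larger
  -- operator `ρ_A ⊗ ρ_B`.
  have hcross : crossEntropy W (fun i => c⁻¹ * p i) ρ - vnEntropy ρ = Real.log c := by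
    rw [crossEntropy, hW.vnEntropy_eq, ← Finset.sum_neg_distrib, ← Finset.sum_sub_distrib,
      ← one_mul (Real.log c), ← hsum, Finset.sum_mul]
    refine Finset.sum_congr rfl fun j _ => ?_
    rw [hdiag, Real.negMulLog]
    by_cases hj : p j = 0
    · simp [hj]
    · rw [Real.log_mul hc'.ne' hj, Real.log_inv]
      ring
  rw [mutualInfo_eq_crossEntropy hρ hA hB, ← hcross]
  refine crossEntropy_sub_vnEntropy_le hW (hW.smul c⁻¹) hW (hA.kronecker hB) hρ
    (hρ.smul (Complex.zero_le_real.mpr hc'.le)) hρ (pA.kronecker pB) ?_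
    (re_conj_diag_eq_zero hρ hA hB) rfl ?_
  · intro j hj
    rw [hdiag]
    exact (mul_eq_zero.mp hj).resolve_left hc'.ne'
  · intro t _ X
    -- The same `X` serves: only the last term of the functional changes, and a larger second
    -- operator lowers the value.
    refine ⟨X, ?_⟩
    have h1 := (Complex.le_def.mp (h.conjTranspose_mul_mul_same X).trace_nonneg).1
    rw [Matrix.mul_assoc, trace_mul_comm, Matrix.mul_assoc, trace_mul_comm, Matrix.mul_sub,
      trace_sub, Complex.sub_re, Complex.zero_re] at h1
    simp only [resolventFunctional]
    linarith

end PartialTrace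

/-! ### Local channels: positivity, trace and no-signalling -/

section TensorApply

/-- The Schur product theorem, iterated. -/
theorem posSemidef_of_prod {ι σ : Type*} [Fintype ι] [DecidableEq ι]
    (S : Finset σ) {C : σ → Matrix ι ι ℂ} (h : ∀ s, (C s).PosSemidef) :
    (of fun i j => ∏ s ∈ S, C s i j).PosSemidef := by
  classical
  induction S using Finset.induction_on with
  | empty =>
    have heq : (of fun i j => ∏ s ∈ ∅, C s i j) = vecMulVec (1 : ι → ℂ) (star 1) := by
      ext i j
      simp [vecMulVec]
    rw [heq]
    exact posSemidef_vecMulVec_self_star (1 : ι → ℂ)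
  | insert s S hs ih =>
    have heq : (of fun i j => ∏ s ∈ insert s S, C s i j) = C s ⊙ of fun i j => ∏ s ∈ S, C s i j := by
      ext i j
      simp [Finset.prod_insert hs]
    rw [heq]
    exact (h s).hadamard ih

variable {N d' d : ℕ}

/-- The Choi matrix of a channel. -/
def choi (Λ : Channel d' d) : Matrix (Fin d × Fin d') (Fin d × Fin d') ℂ :=
  fun i j => Λ.toMap (Matrix.single i.2 j.2 1) i.1 j.1

/-- Complete positivity is applied to the unnormalized maximally entangled projector. -/
theorem choi_posSemidef (Λ : Channel d' d) : (choi Λ).PosSemidef := by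
  have h := Λ.completelyPositive d' _ (posSemidef_vecMulVec_self_star
    (fun x : Fin d' × Fin d' => if x.1 = x.2 then (1 : ℂ) else 0))
  refine (congrArg PosSemidef ?_).mp h
  ext i j
  simp only [choi, ampliate]
  refine congrArg (fun Z => Λ.toMap Z i.1 j.1) ?_
  ext a b
  simp only [single_apply, of_apply, vecMulVec_apply, Pi.star_apply, eq_comm (a := a),
    eq_comm (a := b)]
  by_cases h1 : i.2 = a <;> by_cases h2 : j.2 = b <;> simp [h1, h2]

/-- The output has the form `Bᴴ (X ∘ K) B`, where `K` is the entrywise product of the Choi matrices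
and `B` sums over the input indices. Positivity thus follows from Schur products, without composing
channels one system at a time. -/
theorem tensorApply_posSemidef (Λ : Fin N → Channel d' d)
    {X : Matrix (Fin N → Fin d') (Fin N → Fin d') ℂ} (hX : X.PosSemidef) :
    (tensorApply Λ X).PosSemidef := by
  have hK := posSemidef_of_prod Finset.univ fun s => (choi_posSemidef (Λ s)).submatrix
    (fun p : (Fin N → Fin d) × (Fin N → Fin d') => (p.1 s, p.2 s))
  have hZ := ((hX.submatrix Prod.snd).hadamard hK).conjTranspose_mul_mul_same
    (of fun (p : (Fin N → Fin d) × (Fin N → Fin d')) x => if p.1 = x then (1 : ℂ) else 0)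
  refine (congrArg PosSemidef ?_).mp hZ
  ext x y
  symm
  simp only [tensorApply, mul_apply, Fintype.sum_prod_type, conjTranspose_apply, of_apply,
    hadamard_apply, submatrix_apply, apply_ite star, star_one, star_zero, ite_mul, one_mul,
    zero_mul, mul_ite, mul_one, mul_zero, choi]
  rw [Finset.sum_eq_single y (fun b _ hb => by simp [hb]) (by simp), Finset.sum_comm]
  refine Finset.sum_congr rfl fun y' _ => ?_
  rw [if_pos rfl, Finset.sum_eq_single x (fun b _ hb => by simp [hb]) (by simp)]
  simp

theorem trace_tensorApply (Λ : Fin N → Channel d' d)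
    (X : Matrix (Fin N → Fin d') (Fin N → Fin d') ℂ) : (tensorApply Λ X).trace = X.trace := by
  have h : ∀ x' y' : Fin N → Fin d',
      ∑ x : Fin N → Fin d, ∏ s, (Λ s).toMap (single (x' s) (y' s) 1) (x s) (x s)
        = if x' = y' then 1 else 0 := by
    intro x' y'
    have h1 := (Finset.prod_univ_sum (fun _ : Fin N => (Finset.univ : Finset (Fin d)))
      fun s b => (Λ s).toMap (single (x' s) (y' s) 1) b b).symm
    rw [Fintype.piFinset_univ] at h1
    rw [h1]
    have h2 : ∀ s, ∑ b, (Λ s).toMap (single (x' s) (y' s) 1) b b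
        = if x' s = y' s then 1 else 0 := by
      intro s
      have := (Λ s).tracePreserving (single (x' s) (y' s) 1)
      rw [trace] at this
      refine this.trans ?_
      split_ifs with hs
      · rw [hs, trace_single_eq_same]
      · rw [trace_single_eq_of_ne _ _ _ hs]
    simp only [h2]
    split_ifs with hxy
    · exact Finset.prod_eq_one fun s _ => by rw [hxy, if_pos rfl]
    · obtain ⟨s, hs⟩ := Function.ne_iff.mp hxy
      exact Finset.prod_eq_zero (Finset.mem_univ s) (if_neg hs)
  simp only [trace, diag_apply, tensorApply]
  rw [Finset.sum_comm]
  refine Finset.sum_congr rfl fun x' _ => ?_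
  rw [Finset.sum_comm]
  simp only [← Finset.mul_sum, h]
  simp

variable {T : ℕ}

/-- The splitting of `N` systems into `π(1), …, π(T)` and the others. -/
def splitSystems (hT : T ≤ N) (π : Equiv.Perm (Fin N)) (d : ℕ) :
    (Fin N → Fin d) ≃ (Fin T → Fin d) × ({j : Fin N // ¬ (j : ℕ) < T} → Fin d) :=
  ((Equiv.arrowCongr π.symm (Equiv.refl _)).trans
    (Equiv.piEquivPiSubtypeProd (fun j : Fin N => (j : ℕ) < T) fun _ => Fin d)).trans
    ((Equiv.arrowCongr (Fin.castLEquiv hT).symm (Equiv.refl _)).prodCongr (Equiv.refl _))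

theorem splitSystems_fst (hT : T ≤ N) (π : Equiv.Perm (Fin N)) (x : Fin N → Fin d) (j : Fin T) :
    (splitSystems hT π d x).1 j = x (π (Fin.castLE hT j)) := rfl

theorem splitSystems_snd (hT : T ≤ N) (π : Equiv.Perm (Fin N)) (x : Fin N → Fin d)
    (j : {j : Fin N // ¬ (j : ℕ) < T}) : (splitSystems hT π d x).2 j = x (π j) := rfl

theorem reduce_eq_traceSnd (hT : T ≤ N) (π : Equiv.Perm (Fin N))
    (X : Matrix (Fin N → Fin d) (Fin N → Fin d) ℂ) :
    reduce hT π X = traceSnd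
      (X.submatrix (splitSystems hT π d).symm (splitSystems hT π d).symm) := by
  set e := splitSystems hT π d
  ext a a'
  have hcond : ∀ x x' : Fin N → Fin d,
      ((∀ j, x (π (Fin.castLE hT j)) = a j) ∧ (∀ j, x' (π (Fin.castLE hT j)) = a' j) ∧
        (∀ j : Fin N, T ≤ (j : ℕ) → x (π j) = x' (π j)))
      ↔ ((e x).1 = a ∧ (e x').1 = a' ∧ (e x).2 = (e x').2) := by
    intro x x'
    simp only [funext_iff, e, splitSystems_fst, splitSystems_snd, Subtype.forall, not_lt]
  simp only [reduce, hcond, traceSnd, submatrix_apply]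
  rw [← e.symm.sum_comp]
  simp_rw [fun f : (Fin N → Fin d) → ℂ => (e.symm.sum_comp f).symm]
  simp only [Equiv.apply_symm_apply, Fintype.sum_prod_type, ite_and]
  simp

/-- No signalling: the reduced output state on some systems depends on their channels only. -/
theorem reduce_tensorApply_congr (hT : T ≤ N) (π : Equiv.Perm (Fin N))
    {Λ Λ' : Fin N → Channel d' d}
    (h : ∀ j : Fin T, Λ (π (Fin.castLE hT j)) = Λ' (π (Fin.castLE hT j)))
    (X : Matrix (Fin N → Fin d') (Fin N → Fin d') ℂ) :
    reduce hT π (tensorApply Λ X) = reduce hT π (tensorApply Λ' X) := by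
  rw [reduce_eq_traceSnd, reduce_eq_traceSnd]
  set e := splitSystems hT π d with he
  -- Summing over the discarded outputs factorizes, and trace preservation replaces each discarded
  -- channel by the trace of its input.
  have key : ∀ (Λ : Fin N → Channel d' d) (x' y' : Fin N → Fin d') (a a' : Fin T → Fin d),
      ∑ c, ∏ s, (Λ s).toMap (single (x' s) (y' s) 1) (e.symm (a, c) s) (e.symm (a', c) s)
        = (∏ j : Fin T, (Λ (π (Fin.castLE hT j))).toMap
            (single (x' (π (Fin.castLE hT j))) (y' (π (Fin.castLE hT j))) 1) (a j) (a' j))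
          * ∏ j : {j : Fin N // ¬ (j : ℕ) < T}, (single (x' (π j)) (y' (π j)) (1 : ℂ)).trace := by
    intro Λ x' y' a a'
    have hfst : ∀ (a : Fin T → Fin d) c (j : Fin T),
        e.symm (a, c) (π (Fin.castLE hT j)) = a j := fun a c j =>
      (splitSystems_fst hT π _ j).symm.trans (by rw [← he, Equiv.apply_symm_apply])
    have hsnd : ∀ (a : Fin T → Fin d) c (j : {j : Fin N // ¬ (j : ℕ) < T}),
        e.symm (a, c) (π j) = c j := fun a c j =>
      (splitSystems_snd hT π _ j).symm.trans (by rw [← he, Equiv.apply_symm_apply])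
    have hprod : ∀ f : Fin N → ℂ, ∏ s, f s = (∏ j : Fin T, f (π (Fin.castLE hT j)))
        * ∏ j : {j : Fin N // ¬ (j : ℕ) < T}, f (π j) := by
      intro f
      rw [← Equiv.prod_comp π f, ← Fintype.prod_subtype_mul_prod_subtype (fun j : Fin N => (j : ℕ) < T),
        ← (Fin.castLEquiv hT).prod_comp]
      rfl
    simp only [hprod, hfst, hsnd, ← Finset.mul_sum]
    congr 1
    have h1 := (Finset.prod_univ_sum
      (fun _ : {j : Fin N // ¬ (j : ℕ) < T} => (Finset.univ : Finset (Fin d)))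
      fun j b => (Λ (π j)).toMap (single (x' (π j)) (y' (π j)) 1) b b).symm
    rw [Fintype.piFinset_univ] at h1
    rw [h1]
    exact Finset.prod_congr rfl fun j _ => (Λ (π j)).tracePreserving _
  ext a a'
  simp only [traceSnd, submatrix_apply, tensorApply]
  rw [Finset.sum_comm, Finset.sum_comm (s := Finset.univ (α := {j : Fin N // ¬ (j : ℕ) < T} → Fin d))]
  refine Finset.sum_congr rfl fun x' _ => ?_
  rw [Finset.sum_comm, Finset.sum_comm (s := Finset.univ (α := {j : Fin N // ¬ (j : ℕ) < T} → Fin d))]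
  refine Finset.sum_congr rfl fun y' _ => ?_
  rw [← Finset.mul_sum, ← Finset.mul_sum, key, key]
  simp only [h]

theorem reduce_posSemidef (hT : T ≤ N) (π : Equiv.Perm (Fin N))
    {X : Matrix (Fin N → Fin d) (Fin N → Fin d) ℂ} (hX : X.PosSemidef) :
    (reduce hT π X).PosSemidef := by
  rw [reduce_eq_traceSnd]
  exact traceSnd_posSemidef (hX.submatrix _)

theorem trace_reduce (hT : T ≤ N) (π : Equiv.Perm (Fin N))
    (X : Matrix (Fin N → Fin d) (Fin N → Fin d) ℂ) : (reduce hT π X).trace = X.trace := by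
  rw [reduce_eq_traceSnd, trace_traceSnd]
  exact (splitSystems hT π d).symm.sum_comp fun i => X i i

end TensorApply

/-! ### Classical-quantum states and conditioning on a classical system -/

section ClassicalQuantum

set_option linter.unusedSectionVars false

variable {A B C : Type*} [Fintype A] [DecidableEq A] [Fintype B] [DecidableEq B]
  [Fintype C] [DecidableEq C]

/-- The classical-quantum matrix `∑_a |a⟩⟨a| ⊗ R a`. -/
def cqState (R : A → Matrix B B ℂ) : Matrix (A × B) (A × B) ℂ :=
  fun x x' => if x.1 = x'.1 then R x.1 x.2 x'.2 else 0

theorem cqState_posSemidef {R : A → Matrix B B ℂ} (h : ∀ a, (R a).PosSemidef) :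
    (cqState R).PosSemidef := by
  have hR : cqState R = ∑ a, diagonal (Pi.single a (1 : ℂ)) ⊗ₖ R a := by
    ext ⟨x, b⟩ ⟨x', b'⟩
    simp only [cqState, Matrix.sum_apply, kronecker_apply, diagonal_apply, ite_mul, zero_mul]
    split_ifs with hx
    · rw [Finset.sum_eq_single x (fun a _ ha => by simp [ha.symm]) (by simp)]
      simp
    · simp
  rw [hR]
  refine posSemidef_sum _ fun a _ => PosSemidef.kronecker (PosSemidef.diagonal ?_) (h a)
  exact Pi.single_nonneg.mpr zero_le_one

theorem traceSnd_cqState (R : A → Matrix B B ℂ) :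
    traceSnd (cqState R) = diagonal fun a => (R a).trace := by
  ext a a'
  simp only [traceSnd, cqState, diagonal_apply]
  split_ifs with h
  · rw [h]; rfl
  · simp

theorem traceFst_cqState (R : A → Matrix B B ℂ) : traceFst (cqState R) = ∑ a, R a := by
  ext b b'
  simp [traceFst, cqState, Matrix.sum_apply]

theorem trace_cqState (R : A → Matrix B B ℂ) : (cqState R).trace = ∑ a, (R a).trace := by
  rw [← trace_traceSnd, traceSnd_cqState, trace_diagonal]

/-- A uniformly distributed classical system has mutual information at most `log |A|` with any
other system. -/
theorem mutualInfo_cqState_le {R : A → Matrix B B ℂ} (h : ∀ a, (R a).PosSemidef)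
    (htr : ∀ a, (R a).trace = (Fintype.card A : ℂ)⁻¹) :
    mutualInfo (cqState R) ≤ Real.log (Fintype.card A) := by
  rcases isEmpty_or_nonempty A with hA | hA
  · have h1 : cqState R = diagonal fun _ => ((0 : ℝ) : ℂ) := by
      ext x
      exact isEmptyElim x.1
    have h2 : traceSnd (cqState R) = diagonal fun _ => ((0 : ℝ) : ℂ) := by
      ext x
      exact isEmptyElim x
    have h3 : traceFst (cqState R) = diagonal fun _ => ((0 : ℝ) : ℂ) := by
      rw [traceFst_cqState]
      simp
    rw [mutualInfo, h2, h3, h1, vnEntropy_diagonal, vnEntropy_diagonal, vnEntropy_diagonal]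
    simp
  · have hc : (0 : ℝ) < Fintype.card A := by exact_mod_cast Fintype.card_pos
    refine mutualInfo_le_log hc (cqState_posSemidef h) ?_ ?_
    · rw [trace_cqState]
      simp only [htr, Finset.sum_const, Finset.card_univ, nsmul_eq_mul]
      exact mul_inv_cancel₀ (by exact_mod_cast hc.ne')
    · have heq : traceSnd (cqState R) ⊗ₖ traceFst (cqState R)
          - (((Fintype.card A : ℝ)⁻¹ : ℝ) : ℂ) • cqState R
          = cqState fun a => (((Fintype.card A : ℝ)⁻¹ : ℝ) : ℂ) •
              ∑ a' ∈ Finset.univ.erase a, R a' := by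
        rw [traceSnd_cqState, traceFst_cqState]
        ext ⟨x, b⟩ ⟨x', b'⟩
        simp only [Matrix.sub_apply, kronecker_apply, Matrix.smul_apply, cqState, htr, diagonal_apply]
        split_ifs with hx
        · rw [← Finset.add_sum_erase _ _ (Finset.mem_univ x)]
          simp
          ring
        · simp
      rw [heq]
      refine cqState_posSemidef fun a => PosSemidef.smul (posSemidef_sum _ fun a' _ => h a') ?_
      exact Complex.zero_le_real.mpr (inv_nonneg.mpr hc.le)

theorem vnEntropy_blockDiagonal_smul {σ : C → Matrix A A ℂ} (P : C → ℝ)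
    (hσ : ∀ c, (σ c).IsHermitian) {t : ℝ} (htr : ∀ c, (σ c).trace = t) :
    vnEntropy (blockDiagonal fun c => (P c : ℂ) • σ c)
      = ∑ c, (P c * vnEntropy (σ c) + Real.negMulLog (P c) * t) := by
  rw [vnEntropy_blockDiagonal fun c => by
    rw [IsHermitian, conjTranspose_smul, (hσ c).eq, Complex.star_def, Complex.conj_ofReal]]
  refine Finset.sum_congr rfl fun c _ => ?_
  rw [vnEntropy_smul (hσ c), htr, Complex.ofReal_re]

/-- The conditional mutual information given a classical system is the average of the mutual
informations given its values. -/
theorem condMutualInfo_classical {P : C → ℝ} {τ : C → Matrix (A × B) (A × B) ℂ}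
    (hτ : ∀ c, (τ c).PosSemidef) {t : ℝ} (htr : ∀ c, (τ c).trace = t)
    (ht : Real.negMulLog t = 0) {ρ : Matrix (A × B × C) (A × B × C) ℂ}
    (hρ : ∀ x x', ρ x x' = if x.2.2 = x'.2.2
      then (P x.2.2 : ℂ) * τ x.2.2 (x.1, x.2.1) (x'.1, x'.2.1) else 0) :
    condMutualInfo ρ = ∑ c, P c * mutualInfo (τ c) := by
  have hA := fun c => traceSnd_posSemidef (hτ c)
  have hB := fun c => traceFst_posSemidef (hτ c)
  have h1 : ρ = (blockDiagonal fun c => (P c : ℂ) • τ c).submatrix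
      (Equiv.prodAssoc A B C).symm (Equiv.prodAssoc A B C).symm := by
    ext x x'
    rw [hρ]
    rfl
  have h2 : traceMid ρ = blockDiagonal fun c => (P c : ℂ) • traceSnd (τ c) := by
    ext x x'
    simp only [traceMid, hρ, blockDiagonal_apply, Matrix.smul_apply, traceSnd, smul_eq_mul,
      Finset.mul_sum]
    split_ifs <;> simp
  have h3 : traceFst ρ = blockDiagonal fun c => (P c : ℂ) • traceFst (τ c) := by
    ext x x'
    simp only [traceFst, hρ, blockDiagonal_apply, Matrix.smul_apply, smul_eq_mul, Finset.mul_sum]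
    split_ifs <;> simp
  have h4 : traceFst (traceFst ρ) = diagonal fun c => ((P c * t : ℝ) : ℂ) := by
    ext c c'
    simp only [h3]
    simp only [traceFst, blockDiagonal_apply, Matrix.smul_apply, smul_eq_mul, diagonal_apply]
    split_ifs with h
    · have := htr c
      rw [trace, Fintype.sum_prod_type_right] at this
      rw [Complex.ofReal_mul, ← this, Finset.mul_sum]
      rfl
    · simp
  have hherm : (blockDiagonal fun c => (P c : ℂ) • τ c).IsHermitian := by
    rw [IsHermitian, blockDiagonal_conjTranspose]
    congr 1
    funext c
    rw [conjTranspose_smul, (hτ c).isHermitian.eq, Complex.star_def, Complex.conj_ofReal]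
  rw [condMutualInfo, h4, h2, h3, vnEntropy_diagonal]
  conv_lhs => rw [h1]
  rw [vnEntropy_submatrix hherm,
    vnEntropy_blockDiagonal_smul P (fun c => (hτ c).isHermitian) htr,
    vnEntropy_blockDiagonal_smul P (fun c => (hA c).isHermitian) fun c => by
      rw [trace_traceSnd, htr],
    vnEntropy_blockDiagonal_smul P (fun c => (hB c).isHermitian) fun c => by
      rw [traceFst_eq_traceSnd_swap, trace_traceSnd, ← htr c]
      exact (Equiv.prodComm B A).sum_comp fun i => τ c i i]
  simp only [← Finset.sum_sub_distrib]
  refine Finset.sum_congr rfl fun c _ => ?_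
  -- The entropies of the weights `P c` cancel among the four terms. The hypothesis `ht` admits
  -- trace `1` and also trace `0`, the case `M = 0`.
  rw [Real.negMulLog_mul, ht, mutualInfo]
  ring

end ClassicalQuantum

/-! ### Mutual information, Hellinger distance and `ℓ¹` distance -/

section Hellinger

/-- This is `log x ≤ x - 1` at `x = √r / √p`, multiplied by `2p`. -/
theorem mul_log_sub_log_ge {p r : ℝ} (hp : 0 ≤ p) (hr : 0 ≤ r) (h : r = 0 → p = 0) :
    p - r + (√p - √r) ^ 2 ≤ p * (Real.log p - Real.log r) := by
  rcases hp.eq_or_lt with rfl | hp'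
  · simp [Real.sq_sqrt hr]
  · have hr' : 0 < r := lt_of_le_of_ne hr fun h0 => hp'.ne' (h h0.symm)
    have sp := Real.sqrt_pos.mpr hp'
    have sr := Real.sqrt_pos.mpr hr'
    have h1 := Real.log_le_sub_one_of_pos (div_pos sr sp)
    rw [Real.log_div sr.ne' sp.ne', Real.log_sqrt hr, Real.log_sqrt hp] at h1
    have h2 := mul_le_mul_of_nonneg_left h1 hp
    have h3 : p * (√r / √p - 1) = √p * √r - p := by
      nth_rewrite 1 [← Real.sq_sqrt hp]
      field_simp
      rw [mul_sub, Real.mul_self_sqrt hp]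
    nlinarith [Real.sq_sqrt hp, Real.sq_sqrt hr]

variable {X Y : Type*} [Fintype X] [Fintype Y]

/-- The mutual information dominates the squared Hellinger distance to the product of the
marginals. -/
theorem sum_sq_sqrt_sub_le_classicalMutualInfo {J : X × Y → ℝ} (hJ : ∀ z, 0 ≤ J z)
    (hsum : ∑ z, J z = 1) :
    ∑ x, ∑ y, (√(J (x, y)) - √((∑ y', J (x, y')) * ∑ x', J (x', y))) ^ 2
      ≤ classicalMutualInfo J := by
  set a : X → ℝ := fun x => ∑ y, J (x, y) with ha
  set b : Y → ℝ := fun y => ∑ x, J (x, y) with hb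
  have hJa : ∀ x y, J (x, y) ≤ a x := fun x y =>
    Finset.single_le_sum (f := fun y => J (x, y)) (fun y _ => hJ _) (Finset.mem_univ y)
  have hJb : ∀ x y, J (x, y) ≤ b y := fun x y =>
    Finset.single_le_sum (f := fun x => J (x, y)) (fun x _ => hJ _) (Finset.mem_univ x)
  have ha1 : ∑ x, a x = 1 := by rw [← hsum, Fintype.sum_prod_type]
  have hb1 : ∑ y, b y = 1 := by rw [← hsum, Fintype.sum_prod_type_right]
  have hMI : classicalMutualInfo J
      = ∑ x, ∑ y, J (x, y) * (Real.log (J (x, y)) - Real.log (a x * b y)) := by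
    have h1 : ∀ x y, J (x, y) * (Real.log (J (x, y)) - Real.log (a x * b y))
        = J (x, y) * Real.log (J (x, y)) - J (x, y) * Real.log (a x)
          - J (x, y) * Real.log (b y) := by
      intro x y
      by_cases h0 : J (x, y) = 0
      · simp [h0]
      · have hpos : 0 < J (x, y) := lt_of_le_of_ne (hJ _) (Ne.symm h0)
        rw [Real.log_mul (hpos.trans_le (hJa x y)).ne' (hpos.trans_le (hJb x y)).ne']
        ring
    simp only [h1, Finset.sum_sub_distrib, ← Finset.sum_mul]
    rw [Finset.sum_comm (f := fun x y => J (x, y) * Real.log (b y))]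
    simp only [← Finset.sum_mul, classicalMutualInfo, shannonEntropy, Real.negMulLog, neg_mul,
      Finset.sum_neg_distrib, Fintype.sum_prod_type (f := fun x => J x * Real.log (J x))]
    simp only [ha, hb]
    ring
  have hle : ∑ x, ∑ y, (J (x, y) - a x * b y + (√(J (x, y)) - √(a x * b y)) ^ 2)
      ≤ classicalMutualInfo J := by
    rw [hMI]
    refine Finset.sum_le_sum fun x _ => Finset.sum_le_sum fun y _ => ?_
    have ha0 := (hJ (x, y)).trans (hJa x y)
    have hb0 := (hJ (x, y)).trans (hJb x y)
    refine mul_log_sub_log_ge (hJ _) (mul_nonneg ha0 hb0) fun h0 => ?_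
    rcases mul_eq_zero.mp h0 with h | h
    · exact le_antisymm (h ▸ hJa x y) (hJ _)
    · exact le_antisymm (h ▸ hJb x y) (hJ _)
  -- The linear terms drop out because the joint law and the product of its marginals both have mass
  -- `1`.
  have hzero : ∑ x, ∑ y, (J (x, y) - a x * b y) = 0 := by
    simp only [Finset.sum_sub_distrib]
    rw [← Fintype.sum_prod_type, hsum, ← Finset.sum_mul_sum, ha1, hb1]
    norm_num
  simp only [Finset.sum_add_distrib] at hle
  linarith

/-- Cauchy–Schwarz applied to `|p - r| = |√p - √r| (√p + √r)`; the squares of the second factor sum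
to at most `4`. -/
theorem sum_abs_sub_le_of_hellinger {p r : Y → ℝ} (hp : ∀ y, 0 ≤ p y) (hr : ∀ y, 0 ≤ r y)
    (hp1 : ∑ y, p y = 1) (hr1 : ∑ y, r y = 1) {δ : ℝ}
    (h : ∑ y, (√(p y) - √(r y)) ^ 2 ≤ δ) : ∑ y, |p y - r y| ≤ 2 * √δ := by
  have h1 : ∀ y, |p y - r y| = |√(p y) - √(r y)| * |√(p y) + √(r y)| := by
    intro y
    rw [← abs_mul]
    congr 1
    nlinarith [Real.sq_sqrt (hp y), Real.sq_sqrt (hr y)]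
  have h2 : ∑ y, |√(p y) + √(r y)| ^ 2 ≤ 4 := by
    have : ∑ y, (2 * p y + 2 * r y) = 4 := by
      rw [Finset.sum_add_distrib, ← Finset.mul_sum, ← Finset.mul_sum, hp1, hr1]
      norm_num
    rw [← this]
    refine Finset.sum_le_sum fun y _ => ?_
    rw [sq_abs]
    nlinarith [Real.sq_sqrt (hp y), Real.sq_sqrt (hr y), sq_nonneg (√(p y) - √(r y))]
  have h3 := Real.sum_mul_le_sqrt_mul_sqrt Finset.univ (fun y => |√(p y) - √(r y)|)
    (fun y => |√(p y) + √(r y)|)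
  simp only [h1]
  refine h3.trans ?_
  simp only [sq_abs] at h2 ⊢
  have h4 : √(∑ y, (√(p y) + √(r y)) ^ 2) ≤ 2 := by
    rw [show (2 : ℝ) = √4 by rw [show (4 : ℝ) = 2 ^ 2 by norm_num]; simp]
    exact Real.sqrt_le_sqrt h2
  rw [mul_comm]
  exact mul_le_mul h4 (Real.sqrt_le_sqrt h) (Real.sqrt_nonneg _) (by norm_num)

/-- If `K` is uniform and `I(K;Y) ≤ γ`, then the conditional distributions of `Y` given two values
of `K` have `ℓ¹` distance at most `4 √(|K| γ)`. -/
theorem sum_abs_sub_le_of_classicalMutualInfo_le {P : X → Y → ℝ} (hP : ∀ x y, 0 ≤ P x y)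
    (hP1 : ∀ x, ∑ y, P x y = 1) {γ : ℝ}
    (h : classicalMutualInfo (fun z : X × Y => (Fintype.card X : ℝ)⁻¹ * P z.1 z.2) ≤ γ)
    (k i : X) : ∑ y, |P k y - P i y| ≤ 4 * √(Fintype.card X * γ) := by
  have hc : (0 : ℝ) < Fintype.card X := by exact_mod_cast Fintype.card_pos_iff.mpr ⟨k⟩
  set c : ℝ := (Fintype.card X : ℝ)
  have hc' : 0 < c⁻¹ := inv_pos.mpr hc
  set r : Y → ℝ := fun y => c⁻¹ * ∑ x, P x y with hr
  have hr0 : ∀ y, 0 ≤ r y := fun y => mul_nonneg hc'.le (Finset.sum_nonneg fun x _ => hP x y)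
  have hcsum : ∑ _x : X, c⁻¹ = 1 := by
    rw [Finset.sum_const, Finset.card_univ, nsmul_eq_mul]
    exact mul_inv_cancel₀ hc.ne'
  have hr1 : ∑ y, r y = 1 := by
    rw [← Finset.mul_sum, Finset.sum_comm]
    simp only [hP1]
    rw [Finset.mul_sum]
    simpa using hcsum
  have hH := (sum_sq_sqrt_sub_le_classicalMutualInfo
    (J := fun z : X × Y => c⁻¹ * P z.1 z.2) (fun z => mul_nonneg hc'.le (hP _ _)) (by
      rw [Fintype.sum_prod_type]
      simp only [← Finset.mul_sum, hP1, mul_one]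
      exact hcsum)).trans h
  have hterm : ∀ x y, (√(c⁻¹ * P x y) - √((∑ y', c⁻¹ * P x y') * ∑ x', c⁻¹ * P x' y)) ^ 2
      = c⁻¹ * (√(P x y) - √(r y)) ^ 2 := by
    intro x y
    rw [← Finset.mul_sum, ← Finset.mul_sum, hP1, mul_one, Real.sqrt_mul hc'.le,
      Real.sqrt_mul hc'.le, ← mul_sub, mul_pow, Real.sq_sqrt hc'.le]
  simp only [hterm] at hH
  -- Selecting one value of the uniform variable costs the factor `|X|`. Comparing two values
  -- through the mean law `r` later doubles the constant `2`.
  have hx : ∀ x, ∑ y, (√(P x y) - √(r y)) ^ 2 ≤ c * γ := by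
    intro x
    have h1 := (Finset.single_le_sum (f := fun x => ∑ y, c⁻¹ * (√(P x y) - √(r y)) ^ 2)
      (fun x _ => Finset.sum_nonneg fun y _ => mul_nonneg hc'.le (sq_nonneg _))
      (Finset.mem_univ x)).trans hH
    simp only [← Finset.mul_sum] at h1
    rwa [inv_mul_le_iff₀ hc] at h1
  have hdist := fun x => sum_abs_sub_le_of_hellinger (hP x) hr0 (hP1 x) hr1 (hx x)
  have htri : ∑ y, |P k y - P i y| ≤ ∑ y, |P k y - r y| + ∑ y, |P i y - r y| := by
    rw [← Finset.sum_add_distrib]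
    refine Finset.sum_le_sum fun y _ => ?_
    rw [abs_sub_comm (P i y)]
    exact abs_sub_le _ _ _
  linarith [hdist k, hdist i]

theorem eta0_nonneg {x : ℝ} (hx : 0 ≤ x) : 0 ≤ eta0 x := by
  unfold eta0
  split_ifs with h
  · positivity
  · refine Real.negMulLog_nonneg hx ((not_lt.mp h).trans (inv_le_one_of_one_le₀ ?_))
    exact Real.one_le_exp zero_le_one

theorem h2_nonneg (x : ℝ) : 0 ≤ h2 x := by
  unfold h2
  split_ifs with h
  · exact Real.binEntropy_nonneg h.1 h.2
  · exact le_rfl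

end Hellinger

/-! ### States of the protocol and their mutual information -/

namespace Protocol

variable {N F M D' D T : ℕ} {𝒬 : Fin N → Type*} [∀ s, Fintype (𝒬 s)] [∀ s, DecidableEq (𝒬 s)]

section States

set_option linter.unusedSectionVars false

theorem answerState_posSemidef (Ψ : Protocol N F M D' D 𝒬) (m : Fin F → Fin M) (q : ∀ s, 𝒬 s) :
    (Ψ.answerState m q).PosSemidef :=
  tensorApply_posSemidef _ Ψ.sharedState_posSemidef

theorem trace_answerState (Ψ : Protocol N F M D' D 𝒬) (m : Fin F → Fin M) (q : ∀ s, 𝒬 s) :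
    (Ψ.answerState m q).trace = 1 :=
  (trace_tensorApply _ _).trans Ψ.sharedState_trace

theorem reduce_answerState_congr (Ψ : Protocol N F M D' D 𝒬) (hT : T ≤ N)
    (π : Equiv.Perm (Fin N)) (m : Fin F → Fin M) {q q' : ∀ s, 𝒬 s}
    (h : colludingQueries hT π q = colludingQueries hT π q') :
    reduce hT π (Ψ.answerState m q) = reduce hT π (Ψ.answerState m q') :=
  reduce_tensorApply_congr hT π (fun j => congrArg (Ψ.encServ _ · m) (congrFun h j)) _

/-- The joint state of `(M_k, 𝒜_T)` given the queries. -/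
def fileState (Ψ : Protocol N F M D' D 𝒬) (hT : T ≤ N) (π : Equiv.Perm (Fin N)) (k : Fin F)
    (q : ∀ s, 𝒬 s) : Matrix (Fin M × (Fin T → Fin D)) (Fin M × (Fin T → Fin D)) ℂ :=
  cqState fun x => ∑ m : Fin F → Fin M, if m k = x
    then ((M : ℂ) ^ F)⁻¹ • reduce hT π (Ψ.answerState m q) else 0

theorem fileState_congr (Ψ : Protocol N F M D' D 𝒬) (hT : T ≤ N) (π : Equiv.Perm (Fin N))
    (k : Fin F) {q q' : ∀ s, 𝒬 s} (h : colludingQueries hT π q = colludingQueries hT π q') :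
    Ψ.fileState hT π k q = Ψ.fileState hT π k q' := by
  simp only [fileState, Ψ.reduce_answerState_congr hT π _ h]

theorem posSemidef_sum_ite {ι n : Type*} [Fintype ι] [Fintype n] (p : ι → Prop) [DecidablePred p]
    {R : ι → Matrix n n ℂ} (hR : ∀ i, (R i).PosSemidef) {c : ℂ} (hc : 0 ≤ c) :
    (∑ i, if p i then c • R i else 0).PosSemidef := by
  refine posSemidef_sum _ fun i _ => ?_
  split_ifs
  · exact (hR i).smul hc
  · exact PosSemidef.zero

theorem inv_pow_nonneg (M F : ℕ) : (0 : ℂ) ≤ ((M : ℂ) ^ F)⁻¹ := by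
  have : (((M : ℝ) ^ F)⁻¹ : ℝ) = ((M : ℂ) ^ F)⁻¹ := by push_cast; rfl
  rw [← this]
  exact Complex.zero_le_real.mpr (by positivity)

theorem trace_fileBlock (Ψ : Protocol N F M D' D 𝒬) (hT : T ≤ N) (π : Equiv.Perm (Fin N))
    (k : Fin F) (q : ∀ s, 𝒬 s) (x : Fin M) :
    (∑ m : Fin F → Fin M, if m k = x
      then ((M : ℂ) ^ F)⁻¹ • reduce hT π (Ψ.answerState m q) else 0).trace
      = (Fintype.card (Fin M) : ℂ)⁻¹ := by
  have hM : (M : ℂ) ≠ 0 := by exact_mod_cast (Fin.pos x).ne'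
  have hF : 0 < F := Fin.pos k
  simp only [trace_sum, apply_ite trace, trace_smul, trace_reduce, trace_answerState, trace_zero]
  -- Fixing file `k` leaves `M ^ (F - 1)` tuples, each of weight `M ^ (-F)`.
  rw [← (Equiv.funSplitAt k (Fin M)).symm.sum_comp, Fintype.sum_prod_type]
  simp only [Equiv.funSplitAt, Equiv.piSplitAt, Equiv.coe_fn_symm_mk, dite_true]
  rw [Finset.sum_comm]
  simp
  obtain ⟨F, rfl⟩ : ∃ G, F = G + 1 := ⟨F - 1, by omega⟩
  field_simp
  simp [pow_succ]

theorem fileBlock_posSemidef (Ψ : Protocol N F M D' D 𝒬) (hT : T ≤ N) (π : Equiv.Perm (Fin N))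
    (k : Fin F) (q : ∀ s, 𝒬 s) (x : Fin M) :
    (∑ m : Fin F → Fin M, if m k = x
      then ((M : ℂ) ^ F)⁻¹ • reduce hT π (Ψ.answerState m q) else 0).PosSemidef :=
  posSemidef_sum_ite _ (fun m => reduce_posSemidef hT π (Ψ.answerState_posSemidef m q))
    (inv_pow_nonneg M F)

theorem fileState_posSemidef (Ψ : Protocol N F M D' D 𝒬) (hT : T ≤ N) (π : Equiv.Perm (Fin N))
    (k : Fin F) (q : ∀ s, 𝒬 s) : (Ψ.fileState hT π k q).PosSemidef :=
  cqState_posSemidef (Ψ.fileBlock_posSemidef hT π k q)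

theorem trace_fileState (Ψ : Protocol N F M D' D 𝒬) (hT : T ≤ N) (π : Equiv.Perm (Fin N))
    (k : Fin F) (q : ∀ s, 𝒬 s) :
    (Ψ.fileState hT π k q).trace = ((if M = 0 then 0 else 1 : ℝ) : ℂ) := by
  rw [fileState, trace_cqState]
  simp only [trace_fileBlock]
  rcases M.eq_zero_or_pos with rfl | hM
  · simp
  · simp [hM.ne']

theorem mutualInfo_fileState_le_log (Ψ : Protocol N F M D' D 𝒬) (hT : T ≤ N)
    (π : Equiv.Perm (Fin N)) (k : Fin F) (q : ∀ s, 𝒬 s) :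
    mutualInfo (Ψ.fileState hT π k q) ≤ Real.log M := by
  have := mutualInfo_cqState_le (Ψ.fileBlock_posSemidef hT π k q) (Ψ.trace_fileBlock hT π k q)
  rwa [Fintype.card_fin] at this

theorem mutualInfo_fileState_nonneg (Ψ : Protocol N F M D' D 𝒬) (hT : T ≤ N)
    (π : Equiv.Perm (Fin N)) (k : Fin F) (q : ∀ s, 𝒬 s) :
    0 ≤ mutualInfo (Ψ.fileState hT π k q) := by
  refine mutualInfo_nonneg (Ψ.fileState_posSemidef hT π k q) ?_
  rw [trace_fileState, Complex.ofReal_re]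
  split_ifs <;> norm_num

theorem serverState_eq_cqState (Ψ : Protocol N F M D' D 𝒬) (i : Fin F) (q : ∀ s, 𝒬 s) :
    Ψ.serverState i q = cqState fun y => ∑ m : Fin F → Fin M,
      if (∀ j : {j : Fin F // j ≠ i}, m j = y j)
        then ((M : ℂ) ^ F)⁻¹ • Ψ.answerState m q else 0 := by
  ext x x'
  simp only [serverState, cqState, Matrix.sum_apply]
  congr 1
  refine Finset.sum_congr rfl fun m _ => ?_
  split_ifs <;> rfl

theorem serverState_posSemidef (Ψ : Protocol N F M D' D 𝒬) (i : Fin F) (q : ∀ s, 𝒬 s) :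
    (Ψ.serverState i q).PosSemidef := by
  rw [serverState_eq_cqState]
  exact cqState_posSemidef fun y =>
    posSemidef_sum_ite _ (fun m => Ψ.answerState_posSemidef m q) (inv_pow_nonneg M F)

/-- For `i ≠ k`, file `k` is a coordinate of `M_i^c`. The right-hand side does not involve `i`: the
target index affects only the law of the queries. -/
theorem traceSnd_serverState (Ψ : Protocol N F M D' D 𝒬) (hT : T ≤ N) (π : Equiv.Perm (Fin N))
    {k i : Fin F} (hki : k ≠ i) (q : ∀ s, 𝒬 s) :
    traceSnd (((Ψ.serverState i q).submatrix
        ((Equiv.funSplitAt (⟨k, hki⟩ : {j // j ≠ i}) (Fin M)).symm.prodCongr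
          (splitSystems hT π D).symm)
        ((Equiv.funSplitAt (⟨k, hki⟩ : {j // j ≠ i}) (Fin M)).symm.prodCongr
          (splitSystems hT π D).symm)).submatrix
        (Equiv.prodProdProdComm (Fin M) (Fin T → Fin D) _ _)
        (Equiv.prodProdProdComm (Fin M) (Fin T → Fin D) _ _))
      = Ψ.fileState hT π k q := by
  set e := Equiv.funSplitAt (⟨k, hki⟩ : {j // j ≠ i}) (Fin M) with he
  ext ⟨x, a⟩ ⟨x', a'⟩
  have hcond : ∀ (m : Fin F → Fin M) (r : {j : {j // j ≠ i} // j ≠ ⟨k, hki⟩} → Fin M),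
      (∀ j : {j // j ≠ i}, m j = e.symm (x, r) j)
        ↔ (m k = x ∧ (e fun j => m j).2 = r) := by
    intro m r
    rw [← funext_iff, Equiv.eq_symm_apply, Prod.ext_iff]
    rfl
  have hsymm : ∀ r, (e.symm (x, r) = e.symm (x', r)) ↔ x = x' := by
    intro r
    rw [e.symm.apply_eq_iff_eq, Prod.mk.injEq, and_iff_left rfl]
  simp only [traceSnd, submatrix_apply, Equiv.prodProdProdComm_apply, Equiv.prodCongr_apply,
    Prod.map, serverState, fileState, cqState, hsymm, hcond, Fintype.sum_prod_type,
    Matrix.sum_apply, reduce_eq_traceSnd]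
  split_ifs with hx
  · rw [Finset.sum_comm]
    simp only [Finset.sum_comm (t := (Finset.univ : Finset (Fin F → Fin M)))]
    refine Finset.sum_congr rfl fun m _ => ?_
    by_cases hm : m k = x
    · simp [hm, traceSnd, Finset.mul_sum]
    · simp [hm]
  · simp

theorem mutualInfo_fileState_le (Ψ : Protocol N F M D' D 𝒬) (hT : T ≤ N)
    (π : Equiv.Perm (Fin N)) {k i : Fin F} (hki : k ≠ i) (q : ∀ s, 𝒬 s)
    (hq : Ψ.encUser i q ≠ 0) : mutualInfo (Ψ.fileState hT π k q) ≤ Ψ.serverSecrecy := by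
  have hpos := Ψ.serverState_posSemidef i q
  have h1 := mutualInfo_traceSnd_le (hpos.submatrix
    ((Equiv.funSplitAt (⟨k, hki⟩ : {j // j ≠ i}) (Fin M)).symm.prodCongr
      (splitSystems hT π D).symm))
  rw [traceSnd_serverState, mutualInfo_submatrix hpos] at h1
  refine h1.trans ?_
  exact le_ciSup (f := fun x : {x : Fin F × (∀ s, 𝒬 s) // Ψ.encUser x.1 x.2 ≠ 0} =>
    mutualInfo (Ψ.serverState x.1.1 x.1.2)) (Set.finite_range _).bddAbove ⟨(i, q), hq⟩

/-- The distribution of the colluding queries given the target index. -/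
def colludingQueryDist (Ψ : Protocol N F M D' D 𝒬) (hT : T ≤ N) (π : Equiv.Perm (Fin N))
    (i : Fin F) (c : ∀ j : Fin T, 𝒬 (π (Fin.castLE hT j))) : ℝ :=
  ∑ q : (∀ s, 𝒬 s), if colludingQueries hT π q = c then Ψ.encUser i q else 0

theorem colludingQueryDist_nonneg (Ψ : Protocol N F M D' D 𝒬) (hT : T ≤ N)
    (π : Equiv.Perm (Fin N)) (i : Fin F) (c) : 0 ≤ Ψ.colludingQueryDist hT π i c :=
  Finset.sum_nonneg fun q _ => by
    split_ifs
    exacts [Ψ.encUser_nonneg i q, le_rfl]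

theorem colludingQueryDist_sum (Ψ : Protocol N F M D' D 𝒬) (hT : T ≤ N)
    (π : Equiv.Perm (Fin N)) (i : Fin F) : ∑ c, Ψ.colludingQueryDist hT π i c = 1 := by
  simp only [colludingQueryDist]
  rw [Finset.sum_comm, ← Ψ.encUser_sum i]
  simp

theorem jointIndexQuery_eq (Ψ : Protocol N F M D' D 𝒬) (hT : T ≤ N) (π : Equiv.Perm (Fin N)) :
    Ψ.jointIndexQuery hT π = fun z => (Fintype.card (Fin F) : ℝ)⁻¹ *
      Ψ.colludingQueryDist hT π z.1 z.2 := by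
  funext z
  simp only [jointIndexQuery, colludingQueryDist, Finset.mul_sum, mul_ite, mul_zero,
    Fintype.card_fin]

theorem exists_query_of_colludingQueryDist_ne_zero (Ψ : Protocol N F M D' D 𝒬) (hT : T ≤ N)
    (π : Equiv.Perm (Fin N)) (i : Fin F) (c) (h : Ψ.colludingQueryDist hT π i c ≠ 0) :
    ∃ q, colludingQueries hT π q = c ∧ Ψ.encUser i q ≠ 0 := by
  obtain ⟨q, -, hq⟩ := Finset.exists_ne_zero_of_sum_ne_zero h
  split_ifs at hq with hc
  · exact ⟨q, hc, hq⟩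
  · exact absurd rfl hq

theorem nonempty_queries (Ψ : Protocol N F M D' D 𝒬) (i : Fin F) : Nonempty (∀ s, 𝒬 s) := by
  by_contra h
  rw [not_nonempty_iff] at h
  simpa using Ψ.encUser_sum i

/-- The information leaked to the colluding servers is the average, over their queries, of the
information carried by the state `fileState`. -/
theorem colludingInfo_eq (Ψ : Protocol N F M D' D 𝒬) (hT : T ≤ N) (π : Equiv.Perm (Fin N))
    (k : Fin F) {ext : (∀ j : Fin T, 𝒬 (π (Fin.castLE hT j))) → ∀ s, 𝒬 s}
    (hext : ∀ q, colludingQueries hT π (ext (colludingQueries hT π q))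
      = colludingQueries hT π q) :
    Ψ.colludingInfo hT π k = ∑ c, Ψ.colludingQueryDist hT π k c *
      mutualInfo (Ψ.fileState hT π k (ext c)) := by
  refine condMutualInfo_classical (fun c => Ψ.fileState_posSemidef hT π k (ext c))
    (fun c => Ψ.trace_fileState hT π k (ext c)) (by split_ifs <;> simp) ?_
  rintro ⟨x, a, c⟩ ⟨x', a', c'⟩
  simp only [colludingState, fileState, cqState, colludingQueryDist, Matrix.sum_apply]
  by_cases hx : x = x' <;> by_cases hc : c = c' <;> simp only [hx, hc, and_true, and_false,
    if_true, if_false, mul_zero]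
  subst hx hc
  push_cast
  rw [Finset.mul_sum]
  refine Finset.sum_congr rfl fun m _ => ?_
  rw [Finset.sum_mul]
  refine Finset.sum_congr rfl fun q _ => ?_
  by_cases hm : m k = x <;> by_cases hq : colludingQueries hT π q = c
  -- No-signalling permits replacing `q` by the chosen representative of its colluding part.
  · rw [if_pos ⟨hm, hq⟩, if_pos hq, if_pos hm, ← hq,
      Ψ.reduce_answerState_congr hT π m (hext q), Matrix.smul_apply, smul_eq_mul]
    ring
  · simp [hq]
  · simp [hm]
  · simp [hm]

end States

end Protocol

end QPIR

end

/-! ### The bound on the leaked information -/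

theorem lemma5 {N F M D' D T : ℕ} {𝒬 : Fin N → Type*} [∀ s, Fintype (𝒬 s)]
    [∀ s, DecidableEq (𝒬 s)] (hF : 2 ≤ F) (hT : T ≤ N)
    (Ψ : QPIR.Protocol N F M D' D 𝒬) (β γ : ℝ)
    (hβ : Ψ.serverSecrecy ≤ β) (hγ : Ψ.userSecrecy hT ≤ γ) :
    ∀ (π : Equiv.Perm (Fin N)) (k : Fin F),
      Ψ.colludingInfo hT π k ≤
          β + (10 * √(2 * F * γ) * Real.log M + QPIR.eta0 (2 * √(2 * F * γ))
            + 2 * QPIR.h2 (2 * √(2 * F * γ))) ∧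
        (γ = 0 → Ψ.colludingInfo hT π k ≤ β) := by
  intro π k
  have := Fin.nontrivial_iff_two_le.mpr hF
  obtain ⟨i, hik⟩ := exists_ne k
  have := Ψ.nonempty_queries k
  have hext : ∀ q, QPIR.Protocol.colludingQueries hT π
      (Function.invFun (QPIR.Protocol.colludingQueries hT π)
        (QPIR.Protocol.colludingQueries hT π q)) = QPIR.Protocol.colludingQueries (𝒬 := 𝒬) hT π q :=
    fun q => Function.invFun_eq ⟨q, rfl⟩
  set f := fun c => QPIR.mutualInfo (Ψ.fileState hT π k
    (Function.invFun (QPIR.Protocol.colludingQueries hT π) c)) with hf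
  have hf0 : ∀ c, 0 ≤ f c := fun c => Ψ.mutualInfo_fileState_nonneg hT π k _
  have hfM : ∀ c, f c ≤ Real.log M := fun c => Ψ.mutualInfo_fileState_le_log hT π k _
  -- Squeezing through `f` also covers `M = 0`, where `log 0 = 0`.
  have hlog : 0 ≤ Real.log M := (hf0 _).trans
    (hfM (QPIR.Protocol.colludingQueries hT π (Classical.arbitrary _)))
  have hPi : ∑ c, Ψ.colludingQueryDist hT π i c * f c ≤ β := by
    rw [← one_mul β, ← Ψ.colludingQueryDist_sum hT π i, Finset.sum_mul]
    refine Finset.sum_le_sum fun c _ => ?_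
    -- Server secrecy controls only queries of positive probability under target `i`; the others
    -- carry no weight in this average.
    by_cases hc : Ψ.colludingQueryDist hT π i c = 0
    · simp [hc]
    · obtain ⟨q, rfl, hq⟩ := Ψ.exists_query_of_colludingQueryDist_ne_zero hT π i c hc
      refine mul_le_mul_of_nonneg_left ?_ (Ψ.colludingQueryDist_nonneg hT π i _)
      simp only [hf]
      rw [Ψ.fileState_congr hT π k (hext q)]
      exact (Ψ.mutualInfo_fileState_le hT π hik.symm q hq).trans hβ
  have huser : QPIR.classicalMutualInfo (Ψ.jointIndexQuery hT π) ≤ γ :=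
    (le_ciSup (f := fun π => QPIR.classicalMutualInfo (Ψ.jointIndexQuery hT π))
      (Set.finite_range _).bddAbove π).trans hγ
  rw [Ψ.jointIndexQuery_eq] at huser
  have hdist := QPIR.sum_abs_sub_le_of_classicalMutualInfo_le
    (Ψ.colludingQueryDist_nonneg hT π) (Ψ.colludingQueryDist_sum hT π) huser k i
  rw [Fintype.card_fin] at hdist
  have hmain : Ψ.colludingInfo hT π k ≤ β + 4 * √(F * γ) * Real.log M := by
    rw [Ψ.colludingInfo_eq hT π k hext]
    calc ∑ c, Ψ.colludingQueryDist hT π k c * f c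
        ≤ ∑ c, (Ψ.colludingQueryDist hT π i c * f c
          + |Ψ.colludingQueryDist hT π k c - Ψ.colludingQueryDist hT π i c| * Real.log M) := by
          refine Finset.sum_le_sum fun c _ => ?_
          have h1 := mul_le_mul_of_nonneg_right
            (le_abs_self (Ψ.colludingQueryDist hT π k c - Ψ.colludingQueryDist hT π i c)) (hf0 c)
          have h2 := mul_le_mul_of_nonneg_left (hfM c)
            (abs_nonneg (Ψ.colludingQueryDist hT π k c - Ψ.colludingQueryDist hT π i c))
          linarith
      _ ≤ β + 4 * √(F * γ) * Real.log M := by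
          rw [Finset.sum_add_distrib, ← Finset.sum_mul]
          exact add_le_add hPi (mul_le_mul_of_nonneg_right hdist hlog)
  refine ⟨hmain.trans ?_, fun h0 => ?_⟩
  · have hsqrt : √((F : ℝ) * γ) ≤ √(2 * F * γ) := by
      -- The sign of `γ` is not assumed; if `F * γ ≤ 0`, the smaller root is `0`.
      rcases le_total 0 ((F : ℝ) * γ) with h | h
      · exact Real.sqrt_le_sqrt (by linarith)
      · rw [Real.sqrt_eq_zero_of_nonpos h]
        exact Real.sqrt_nonneg _
    have h1 : 4 * √((F : ℝ) * γ) * Real.log M ≤ 10 * √(2 * F * γ) * Real.log M :=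
      mul_le_mul_of_nonneg_right
        (by linarith [Real.sqrt_nonneg (2 * (F : ℝ) * γ)]) hlog
    have h2 : 0 ≤ QPIR.eta0 (2 * √(2 * F * γ)) := QPIR.eta0_nonneg (by positivity)
    have h3 := QPIR.h2_nonneg (2 * √(2 * F * γ))
    linarith
  · simpa [h0] using hmain
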